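/- Let $\alpha>0$, $\beta>0$ and $L=e^{-\alpha-\beta}$. (These parameters arise from the $q$-weighted cut hexagon with $q=e^{-\varepsilon}$, $n\varepsilon\to\alpha$, $k\varepsilon\to\beta$ as $\varepsilon\to0^+$.) Call a bounded measurable function $\sigma:[L,1]\to[0,\infty)$ a solution if (i) for every point $z\in(L,1)$ of the support of the measure $\sigma(u)\,du$ on $[L,1]$, $$\ln\frac{z-L}{1-z}=\mathrm{p.v.}\!\int_L^1\frac{\sigma(u)\,du}{z-u},\qquad\text{where}\quad \mathrm{p.v.}\!\int_L^1\frac{\sigma(u)\,du}{z-u}=\lim_{\epsilon\to0^+}\int_{\{u\in[L,1]:\,|u-z|>\epsilon\}}\frac{\sigma(u)\,du}{z-u}$$ (the limit exists and equals the left-hand side), and (ii) $\displaystyle\int_L^1\frac{\sigma(u)}{u}\,du=\beta$. Then there are real numbers $0<B<A<\alpha+\beta$ with $$e^{-B}=e^{-\frac{\alpha+\beta}{2}}\left(\cosh\tfrac{\alpha+\beta}{2}+\sqrt{\sinh\tfrac{\beta}{2}\,\sinh\tfrac{2\alpha+\beta}{2}}\right),\qquad e^{-A}=e^{-\frac{\alpha+\beta}{2}}\left(\cosh\tfrac{\alpha+\beta}{2}-\sqrt{\sinh\tfrac{\beta}{2}\,\sinh\tfrac{2\alpha+\beta}{2}}\right),$$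 and, up to equality almost everywhere on $[L,1]$, there is exactly one solution $\sigma$. It is given by $\sigma(e^{-\mu})=\rho(\mu)$ for $\mu\in[0,\alpha+\beta]$, where $$\rho(\mu)=\frac{2}{\pi}\arctan\left(e^{-\mu/2}\sqrt{\frac{\sinh\frac{\mu-A}{2}\,\sinh\frac{B-\mu}{2}}{\sinh\frac{A}{2}\,\sinh\frac{B}{2}}}\right)\quad\text{for }\mu\in[B,A],\qquad \rho(\mu)=0\quad\text{for }\mu\notin[B,A],$$ and the support of $\rho$ is exactly $[B,A]$. -/

import Mathlib

open MeasureTheory Filter Topology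

noncomputable section

namespace CutHexagon

/-- The left end `L = e^{-α-β}` of the interval `[L, 1]` in the variable `u = e^{-μ}`. -/
def leftEnd (α β : ℝ) : ℝ := Real.exp (-α - β)

/-- `v` is the Cauchy principal value of `∫_L^1 σ(u) du / (z - u)`: the limit as `ε → 0+` of the
integrals over `{u ∈ [L, 1] : |u - z| > ε}`. -/
def HasPrincipalValue (L : ℝ) (σ : ℝ → ℝ) (z v : ℝ) : Prop :=
  Tendsto (fun ε : ℝ => ∫ u in {u : ℝ | u ∈ Set.Icc L 1 ∧ ε < |u - z|}, σ u / (z - u))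
    (𝓝[>] 0) (𝓝 v)

/-- The measure `σ(u) du` on `[L, 1]` (for a nonnegative density `σ`). -/
def densityMeasure (L : ℝ) (σ : ℝ → ℝ) : Measure ℝ :=
  (volume.restrict (Set.Icc L 1)).withDensity (fun u => ENNReal.ofReal (σ u))

/-- A density `σ` on `[L, 1]`, `L = e^{-α-β}`, that solves the singular integral equation
`ln ((z - L) / (1 - z)) = p.v. ∫_L^1 σ(u) du / (z - u)` at every point `z ∈ (L, 1)` of its support
and satisfies the constraint `∫_L^1 σ(u) / u du = β`.
Only the values of `σ` on `[L, 1]` matter. -/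
structure IsSolution (α β : ℝ) (σ : ℝ → ℝ) : Prop where
  aemeasurable : AEMeasurable σ (volume.restrict (Set.Icc (leftEnd α β) 1))
  nonneg : ∀ u ∈ Set.Icc (leftEnd α β) 1, 0 ≤ σ u
  bounded : ∃ C : ℝ, ∀ u ∈ Set.Icc (leftEnd α β) 1, σ u ≤ C
  integral_equation : ∀ z ∈ Set.Ioo (leftEnd α β) 1,
    z ∈ (densityMeasure (leftEnd α β) σ).support →
      HasPrincipalValue (leftEnd α β) σ z (Real.log ((z - leftEnd α β) / (1 - z)))
  constraint : ∫ u in Set.Icc (leftEnd α β) 1, σ u / u = β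

open Classical in
/-- The density `ρ` with end points `B < A`: the arctangent formula on `[B, A]`, zero elsewhere. -/
def limitDensity (A B : ℝ) (μ : ℝ) : ℝ :=
  if μ ∈ Set.Icc B A then
    (2 / Real.pi) * Real.arctan (Real.exp (-μ / 2) *
      Real.sqrt ((Real.sinh ((μ - A) / 2) * Real.sinh ((B - μ) / 2)) /
        (Real.sinh (A / 2) * Real.sinh (B / 2))))
  else 0

end CutHexagon

end

/-! The support of a solution is an interval: across a gap $(a',b')$ of it the principal value
cannot increase from $a'$ to $b'$, because $\sigma(u)/(z-u)$ decreases in $z$ for each fixed $u$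
outside the gap, whereas $\ln\frac{z-L}{1-z}$ strictly increases (`hasPV_le_of_gap`,
`eq_Icc_of_hasPV`).

On a support $[c-r,c+r]$ put $u=c+r\cos\varphi$ and $Z=c+\frac r2(w+w^{-1})$. The Cauchy transform
becomes the power series $\sum 2s_nw^n$, where $s_n$ are the sine moments of
$\varphi\mapsto\sigma(c+r\cos\varphi)$ (`hasSum_cauchyTransform_joukowski`). A principal value is
the radial limit of its real part (`tendsto_re_cauchyTransform_joukowski`), and an $L^2$ argument
for Abel means identifies the cosine coefficients of the right-hand side with $\pi s_n$
(`integral_pv_mul_cos`). Hence the density on a given interval is unique (`ae_eq_of_hasPV`). Since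
$s_0=0$, the right-hand side has mean zero in $\theta$; being increasing and odd about $(1+L)/2$, it
forces $2c=1+L$ (`two_mul_center_eq_of_integral_eq_zero`).

If the interval is all of $[L,1]$, the solution is the constant $1$, whose weighted mass is
$\alpha+\beta\ne\beta$. Otherwise it is `arcDensity`, whose resolvent is $2\ln\frac{1+qw}{1-qw}$
(`cauchyTransform_arcDensity`, `hasPV_arcDensity`). Evaluating the resolvent at $Z=0$ turns the mass
constraint into a formula for $ab$ (`integral_arcDensity_div_eq_iff`). Together with $a+b=1+L$ this
fixes both end points, and the same computations show that this density is a solution. -/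

noncomputable section

namespace CutHexagon

/-! ### Sine moments and Parseval's identity -/

/-- The `n`-th sine moment of `p` over `[0, π]`. -/
def sineMoment (p : ℝ → ℝ) (n : ℕ) : ℝ := ∫ x in (0 : ℝ)..Real.pi, p x * Real.sin (n * x)

theorem integral_cos_int_mul (k : ℤ) (hk : k ≠ 0) :
    ∫ x in (0 : ℝ)..Real.pi, Real.cos (k * x) = 0 := by
  have hk' : (k : ℝ) ≠ 0 := by exact_mod_cast hk
  rw [intervalIntegral.integral_comp_mul_left (fun x => Real.cos x) hk', integral_cos]
  simp [Real.sin_int_mul_pi]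

theorem integral_cos_mul_cos (m n : ℕ) (hm : m ≠ 0) :
    ∫ x in (0 : ℝ)..Real.pi, Real.cos (m * x) * Real.cos (n * x)
      = if m = n then Real.pi / 2 else 0 := by
  have h : ∀ x : ℝ, Real.cos (m * x) * Real.cos (n * x)
      = (1 / 2) * (Real.cos (((m - n : ℤ) : ℝ) * x) + Real.cos (((m + n : ℤ) : ℝ) * x)) := by
    intro x
    push_cast
    rw [sub_mul, add_mul, Real.cos_sub, Real.cos_add]
    ring
  simp_rw [h]
  rw [intervalIntegral.integral_const_mul, intervalIntegral.integral_add
    (Continuous.intervalIntegrable (by fun_prop) _ _)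
    (Continuous.intervalIntegrable (by fun_prop) _ _), integral_cos_int_mul (m + n) (by omega)]
  split_ifs with hmn
  · subst hmn
    simp
    ring
  · rw [integral_cos_int_mul (m - n) (by omega)]
    simp

theorem integral_sin_mul_sin (m n : ℕ) (hm : m ≠ 0) :
    ∫ x in (0 : ℝ)..Real.pi, Real.sin (m * x) * Real.sin (n * x)
      = if m = n then Real.pi / 2 else 0 := by
  have h : ∀ x : ℝ, Real.sin (m * x) * Real.sin (n * x)
      = (1 / 2) * (Real.cos (((m - n : ℤ) : ℝ) * x) - Real.cos (((m + n : ℤ) : ℝ) * x)) := by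
    intro x
    push_cast
    rw [sub_mul, add_mul, Real.cos_sub, Real.cos_add]
    ring
  simp_rw [h]
  rw [intervalIntegral.integral_const_mul, intervalIntegral.integral_sub
    (Continuous.intervalIntegrable (by fun_prop) _ _)
    (Continuous.intervalIntegrable (by fun_prop) _ _), integral_cos_int_mul (m + n) (by omega)]
  split_ifs with hmn
  · subst hmn
    simp
    ring
  · rw [integral_cos_int_mul (m - n) (by omega)]
    simp

/-- The odd extension of `p` from `[0, π]` to `[-π, π]`, complex valued. -/
def oddExtension (p : ℝ → ℝ) (x : ℝ) : ℂ := if 0 < x then (p x : ℂ) else -(p (-x) : ℂ)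

theorem intervalIntegrable_of_bounded {p : ℝ → ℝ} (hp : Measurable p) {M : ℝ}
    (hM : ∀ x, |p x| ≤ M) (a b : ℝ) : IntervalIntegrable p volume a b := by
  refine (intervalIntegrable_const (c := M)).mono_fun' hp.aestronglyMeasurable ?_
  exact ae_of_all _ fun x => hM x

theorem measurable_oddExtension {p : ℝ → ℝ} (hp : Measurable p) :
    Measurable (oddExtension p) := by
  unfold oddExtension
  refine Measurable.ite measurableSet_Ioi ?_ ?_ <;> fun_prop

theorem norm_oddExtension_le {p : ℝ → ℝ} {M : ℝ} (hM : ∀ x, |p x| ≤ M) (x : ℝ) :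
    ‖oddExtension p x‖ ≤ M := by
  unfold oddExtension
  split_ifs
  · simpa using hM x
  · simpa using hM (-x)

/-- Oddness cancels the cosine part, so Parseval on $[-\pi,\pi]$ becomes a statement about sine
moments alone. -/
theorem fourierCoeffOn_oddExtension {p : ℝ → ℝ} (hp : Measurable p) {M : ℝ}
    (hM : ∀ x, |p x| ≤ M) (n : ℤ) :
    fourierCoeffOn (neg_lt_self Real.pi_pos) (oddExtension p) n
      = (-Complex.I / Real.pi) * (∫ x in (0 : ℝ)..Real.pi, p x * Real.sin (n * x) : ℝ) := by
  rw [fourierCoeffOn_eq_integral]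
  have e : ∀ x : ℝ, fourier (-n) (x : AddCircle (Real.pi - -Real.pi)) • oddExtension p x
      = Complex.exp (-(n * x * Complex.I)) * oddExtension p x := by
    intro x
    rw [fourier_coe_apply, smul_eq_mul]
    congr 2
    push_cast
    have : (Real.pi : ℂ) ≠ 0 := by exact_mod_cast Real.pi_ne_zero
    field_simp
    ring
  simp_rw [e]
  set F : ℝ → ℂ := fun x => Complex.exp (-(n * x * Complex.I)) * oddExtension p x with hF
  have hFi : ∀ a b, IntervalIntegrable F volume a b := by
    intro a b
    refine (intervalIntegrable_const (c := M)).mono_fun' ?_ (ae_of_all _ fun x => ?_)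
    · exact (((by fun_prop : Continuous fun x : ℝ => Complex.exp (-(n * x * Complex.I))).measurable
        |>.mul (measurable_oddExtension hp)).aestronglyMeasurable)
    · have h1 : ‖Complex.exp (-(n * x * Complex.I))‖ = 1 := by
        rw [Complex.norm_exp]; simp
      simp only [hF, norm_mul, h1, one_mul]
      exact norm_oddExtension_le hM x
  have hFn : IntervalIntegrable (fun x => F (-x)) volume 0 Real.pi := by
    simpa using (IntervalIntegrable.iff_comp_neg (f := F)).1 (hFi (-0) (-Real.pi))
  have hs : ∫ x in (-Real.pi)..Real.pi, F x = ∫ x in (0 : ℝ)..Real.pi, (F (-x) + F x) := by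
    rw [← intervalIntegral.integral_add_adjacent_intervals (hFi _ 0) (hFi 0 _),
      intervalIntegral.integral_add hFn (hFi _ _),
      intervalIntegral.integral_comp_neg]
    simp
  rw [hs]
  have hc : ∫ x in (0 : ℝ)..Real.pi, (F (-x) + F x)
      = ∫ x in (0 : ℝ)..Real.pi, (-2 * Complex.I) * ((p x * Real.sin (n * x) : ℝ) : ℂ) := by
    rw [intervalIntegral.integral_of_le Real.pi_pos.le,
      intervalIntegral.integral_of_le Real.pi_pos.le]
    refine setIntegral_congr_fun measurableSet_Ioc fun x hx => ?_
    have hx0 : 0 < x := hx.1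
    simp only [hF, oddExtension, if_pos hx0, if_neg (show ¬ (0 < -x) by linarith), neg_neg]
    have h1 : (-(n * ((-x : ℝ) : ℂ) * Complex.I)) = ((n * x : ℂ)) * Complex.I := by
      push_cast; ring
    have h2 : (-((n : ℂ) * (x : ℂ) * Complex.I)) = (-(n * x : ℂ)) * Complex.I := by ring
    rw [h1, h2, Complex.exp_mul_I, Complex.exp_mul_I, Complex.cos_neg, Complex.sin_neg]
    push_cast
    ring
  rw [hc, intervalIntegral.integral_const_mul, intervalIntegral.integral_ofReal]
  rw [Complex.real_smul]
  push_cast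
  have : (Real.pi : ℂ) ≠ 0 := by exact_mod_cast Real.pi_ne_zero
  field_simp
  ring

theorem hasSum_sq_fourierCoeffOn_oddExtension {p : ℝ → ℝ} (hp : Measurable p) {M : ℝ}
    (hM : ∀ x, |p x| ≤ M) :
    HasSum (fun n => ‖fourierCoeffOn (neg_lt_self Real.pi_pos) (oddExtension p) n‖ ^ 2)
      ((Real.pi - -Real.pi)⁻¹ • ∫ x in (-Real.pi)..Real.pi, ‖oddExtension p x‖ ^ 2) := by
  refine hasSum_sq_fourierCoeffOn _ ?_
  exact MemLp.of_bound (measurable_oddExtension hp).aestronglyMeasurable M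
    (ae_of_all _ (norm_oddExtension_le hM))

theorem summable_sq_sineMoment {p : ℝ → ℝ} (hp : Measurable p) {M : ℝ} (hM : ∀ x, |p x| ≤ M) :
    Summable fun n => sineMoment p n ^ 2 := by
  have h := (hasSum_sq_fourierCoeffOn_oddExtension hp hM).summable
  have h2 := (h.comp_injective (Nat.cast_injective (R := ℤ))).mul_left (Real.pi ^ 2)
  refine h2.congr fun n => ?_
  simp only [Function.comp, fourierCoeffOn_oddExtension hp hM, norm_mul, norm_div, norm_neg,
    Complex.norm_I, Complex.norm_real, Int.cast_natCast]
  rw [mul_pow, div_pow, Real.norm_eq_abs, Real.norm_eq_abs, sq_abs, sq_abs, sineMoment]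
  have := Real.pi_ne_zero
  field_simp

/-- Completeness of the sines: by Parseval the odd extension has $L^2$ norm zero. -/
theorem ae_eq_zero_of_sineMoment {p : ℝ → ℝ} (hp : Measurable p) {M : ℝ} (hM : ∀ x, |p x| ≤ M)
    (h0 : ∀ n, sineMoment p n = 0) : ∀ᵐ x ∂volume.restrict (Set.Ioo 0 Real.pi), p x = 0 := by
  have h := hasSum_sq_fourierCoeffOn_oddExtension hp hM
  have hz : ∀ n : ℤ, ∫ x in (0 : ℝ)..Real.pi, p x * Real.sin (n * x) = 0 := by
    intro n
    obtain ⟨k, rfl | rfl⟩ := n.eq_nat_or_neg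
    · simpa [sineMoment] using h0 k
    · simpa [sineMoment] using h0 k
  have hc : ∀ n, fourierCoeffOn (neg_lt_self Real.pi_pos) (oddExtension p) n = 0 := by
    intro n
    rw [fourierCoeffOn_oddExtension hp hM, hz]
    simp
  simp only [hc, norm_zero, ne_eq, OfNat.ofNat_ne_zero, not_false_eq_true, zero_pow] at h
  have hI := h.unique hasSum_zero
  have hI2 : ∫ x in (-Real.pi)..Real.pi, ‖oddExtension p x‖ ^ 2 = 0 := by
    rcases smul_eq_zero.1 hI with h1 | h1
    · have := Real.pi_pos
      rw [inv_eq_zero] at h1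
      linarith
    · exact h1
  rw [intervalIntegral.integral_of_le (by linarith [Real.pi_pos]),
    integral_eq_zero_iff_of_nonneg (fun x => by positivity)] at hI2
  · have hsub : Set.Ioo 0 Real.pi ⊆ Set.Ioc (-Real.pi) Real.pi := fun x hx =>
      ⟨by linarith [hx.1, Real.pi_pos], hx.2.le⟩
    have h3 := ae_mono (Measure.restrict_mono hsub (le_refl volume)) hI2
    filter_upwards [h3, ae_restrict_mem measurableSet_Ioo] with x hx hx'
    simpa [oddExtension, hx'.1] using hx
  · refine Measure.integrableOn_of_bounded (M := M ^ 2) (by simp)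
      ((measurable_oddExtension hp).norm.pow_const 2).aestronglyMeasurable (ae_of_all _ fun x => ?_)
    rw [norm_pow, norm_norm]
    exact pow_le_pow_left₀ (norm_nonneg _) (norm_oddExtension_le hM x) 2

/-! ### Cosine series and their Abel means -/

/-- The cosine series with coefficients `c`. -/
def cosSeries (c : ℕ → ℝ) (x : ℝ) : ℝ := ∑' n, c n * Real.cos (n * x)

theorem abs_mul_cos_le (c x : ℝ) : |c * Real.cos x| ≤ |c| := by
  rw [abs_mul]
  exact mul_le_of_le_one_right (abs_nonneg _) (Real.abs_cos_le_one _)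

theorem hasSum_cosSeries {c : ℕ → ℝ} (hc : Summable fun n => |c n|) (x : ℝ) :
    HasSum (fun n => c n * Real.cos (n * x)) (cosSeries c x) :=
  (Summable.of_norm_bounded hc fun _ => abs_mul_cos_le _ _).hasSum

theorem continuous_cosSeries {c : ℕ → ℝ} (hc : Summable fun n => |c n|) :
    Continuous (cosSeries c) :=
  continuous_tsum (fun n => by fun_prop) hc fun _ _ => abs_mul_cos_le _ _

theorem hasSum_integral_cosSeries_mul {c : ℕ → ℝ} (hc : Summable fun n => |c n|) {φ : ℝ → ℝ}
    (hφ : Continuous φ) :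
    HasSum (fun n => c n * ∫ x in (0 : ℝ)..Real.pi, Real.cos (n * x) * φ x)
      (∫ x in (0 : ℝ)..Real.pi, cosSeries c x * φ x) := by
  have h := intervalIntegral.hasSum_integral_of_dominated_convergence (μ := volume)
    (a := 0) (b := Real.pi)
    (F := fun n x => c n * (Real.cos (n * x) * φ x)) (f := fun x => cosSeries c x * φ x)
    (fun n x => |c n| * |φ x|)
    (fun n => (Continuous.aestronglyMeasurable (by fun_prop)))
    (fun n => ae_of_all _ fun x _ => ?_) (ae_of_all _ fun x _ => hc.mul_right _) ?_
    (ae_of_all _ fun x _ => ?_)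
  · simpa only [intervalIntegral.integral_const_mul] using h
  · rw [← mul_assoc, norm_mul]
    exact mul_le_mul_of_nonneg_right (abs_mul_cos_le _ _) (abs_nonneg _)
  · simp_rw [tsum_mul_right]
    exact Continuous.intervalIntegrable (by fun_prop) _ _
  · simp_rw [← mul_assoc]
    exact (hasSum_cosSeries hc x).mul_right _

theorem integral_cosSeries_mul_cos {c : ℕ → ℝ} (hc : Summable fun n => |c n|) (h0 : c 0 = 0)
    (n : ℕ) :
    ∫ x in (0 : ℝ)..Real.pi, cosSeries c x * Real.cos (n * x) = Real.pi / 2 * c n := by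
  refine (hasSum_integral_cosSeries_mul hc (φ := fun x => Real.cos (n * x))
    (by fun_prop)).unique ?_
  have h := hasSum_single (f := fun m : ℕ =>
    c m * ∫ x in (0 : ℝ)..Real.pi, Real.cos (m * x) * Real.cos (n * x)) n ?_
  · convert h using 1
    rcases eq_or_ne n 0 with rfl | hn
    · simp [h0]
    · rw [integral_cos_mul_cos n n hn, if_pos rfl, mul_comm]
  · intro m hmn
    rcases eq_or_ne m 0 with rfl | hm
    · simp [h0]
    · simp only [integral_cos_mul_cos m n hm, if_neg hmn, mul_zero]

theorem integral_cosSeries_sq {c : ℕ → ℝ} (hc : Summable fun n => |c n|) (h0 : c 0 = 0) :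
    ∫ x in (0 : ℝ)..Real.pi, cosSeries c x ^ 2 = Real.pi / 2 * ∑' n, c n ^ 2 := by
  have h := hasSum_integral_cosSeries_mul hc (continuous_cosSeries hc)
  simp_rw [sq]
  rw [← h.tsum_eq, ← tsum_mul_left]
  refine tsum_congr fun n => ?_
  have := integral_cosSeries_mul_cos hc h0 n
  simp_rw [mul_comm (cosSeries c _) (Real.cos _)] at this
  rw [this]
  ring

theorem summable_abs_mul_pow {s : ℕ → ℝ} (hs : Summable fun n => s n ^ 2) {ρ : ℝ}
    (h0 : 0 ≤ ρ) (h1 : ρ < 1) : Summable fun n => |s n * ρ ^ n| := by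
  have hg : Summable fun n : ℕ => (ρ ^ n) ^ 2 := by
    simp_rw [← pow_mul, mul_comm _ 2, pow_mul]
    exact summable_geometric_of_lt_one (by positivity) (by nlinarith)
  refine Summable.of_nonneg_of_le (fun n => abs_nonneg _) (fun n => ?_) (hs.add hg)
  rw [abs_mul]
  nlinarith [sq_nonneg (|s n| - |ρ ^ n|), sq_abs (s n), sq_abs (ρ ^ n), sq_nonneg (s n),
    sq_nonneg (ρ ^ n)]

/-- If the Abel means of a square summable cosine series converge pointwise, then the limit is
integrable and has the expected cosine coefficients. -/
theorem integral_mul_cos_of_tendsto_abel {s : ℕ → ℝ} (hs : Summable fun n => s n ^ 2)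
    (s0 : s 0 = 0) {h : ℝ → ℝ}
    (hlim : ∀ θ ∈ Set.Ioo 0 Real.pi,
      Tendsto (fun ρ : ℝ => cosSeries (fun n => s n * ρ ^ n) θ) (𝓝[<] 1) (𝓝 (h θ))) :
    IntervalIntegrable h volume 0 Real.pi ∧
      ∀ n : ℕ, ∫ x in (0 : ℝ)..Real.pi, h x * Real.cos (n * x) = Real.pi / 2 * s n := by
  -- A sequence of radii in $[0,1)$ tending to $1$: Fatou's lemma is applied along it.
  set ρ : ℕ → ℝ := fun k => 1 - 1 / (k + 2 : ℝ) with hρ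
  have hρ0 : ∀ k, 0 ≤ ρ k := fun k => by
    have : (1 : ℝ) / (k + 2) ≤ 1 := by
      rw [div_le_one (by positivity)]
      linarith [k.cast_nonneg (α := ℝ)]
    simp only [hρ]; linarith
  have hρ1 : ∀ k, ρ k < 1 := fun k => by
    have : (0 : ℝ) < 1 / (k + 2) := by positivity
    simp only [hρ]; linarith
  have hρt : Tendsto ρ atTop (𝓝 1) := by
    have : Tendsto (fun k : ℕ => (1 : ℝ) / (k + 2)) atTop (𝓝 0) := by
      have := (tendsto_one_div_add_atTop_nhds_zero_nat (𝕜 := ℝ)).comp (tendsto_add_atTop_nat 1)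
      refine this.congr fun k => ?_
      simp only [Function.comp]
      rw [show ((k + 1 : ℕ) : ℝ) + 1 = k + 2 by push_cast; ring]
    simpa [hρ] using this.const_sub 1
  have hρt' : Tendsto ρ atTop (𝓝[<] 1) :=
    tendsto_nhdsWithin_iff.2 ⟨hρt, Eventually.of_forall hρ1⟩
  have hsum : ∀ k, Summable fun n => |s n * ρ k ^ n| := fun k =>
    summable_abs_mul_pow hs (hρ0 k) (hρ1 k)
  set H : ℕ → ℝ → ℝ := fun k => cosSeries fun n => s n * ρ k ^ n with hH
  have hHc : ∀ k, Continuous (H k) := fun k => continuous_cosSeries (hsum k)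
  set μ := volume.restrict (Set.Ioo 0 Real.pi) with hμ
  have hHh : ∀ᵐ x ∂μ, Tendsto (fun k => H k x) atTop (𝓝 (h x)) := by
    filter_upwards [ae_restrict_mem measurableSet_Ioo] with x hx
    exact (hlim x hx).comp hρt'
  have hhm : AEStronglyMeasurable h μ :=
    aestronglyMeasurable_of_tendsto_ae atTop (fun k => (hHc k).aestronglyMeasurable) hHh
  -- The squared $L^2$ distance that is expected between the $k$-th Abel mean and the limit.
  set e : ℕ → ℝ := fun k => Real.pi / 2 * ∑' n, s n ^ 2 * (1 - ρ k ^ n) ^ 2 with he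
  have hp1 : ∀ k n, ρ k ^ n ≤ 1 := fun k n => pow_le_one₀ (hρ0 k) (hρ1 k).le
  have hp0 : ∀ k n, 0 ≤ ρ k ^ n := fun k n => pow_nonneg (hρ0 k) n
  have hesum : ∀ k, Summable fun n => s n ^ 2 * (1 - ρ k ^ n) ^ 2 := fun k =>
    Summable.of_nonneg_of_le (fun n => by positivity) (fun n => by
      have : (1 - ρ k ^ n) ^ 2 ≤ 1 := by nlinarith [hp1 k n, hp0 k n]
      nlinarith [sq_nonneg (s n)]) hs
  have het : Tendsto e atTop (𝓝 0) := by
    have : Tendsto (fun k => ∑' n, s n ^ 2 * (1 - ρ k ^ n) ^ 2) atTop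
        (𝓝 (∑' n : ℕ, s n ^ 2 * (1 - 1 ^ n) ^ 2)) := by
      refine tendsto_tsum_of_dominated_convergence hs (fun n => ?_) (Eventually.of_forall
        fun k n => ?_)
      · exact ((((hρt.pow n).const_sub 1).pow 2).const_mul _)
      · rw [Real.norm_of_nonneg (by positivity)]
        have : (1 - ρ k ^ n) ^ 2 ≤ 1 := by nlinarith [hp1 k n, hp0 k n]
        nlinarith [sq_nonneg (s n)]
    simpa [he] using this.const_mul (Real.pi / 2)
  have hdiff : ∀ j k, ∫⁻ x, ENNReal.ofReal ((H j x - H k x) ^ 2) ∂μ ≤ ENNReal.ofReal (e j + e k) := by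
    intro j k
    have hc : Summable fun n => |s n * ρ j ^ n - s n * ρ k ^ n| :=
      Summable.of_nonneg_of_le (fun _ => abs_nonneg _) (fun _ => abs_sub _ _)
        ((hsum j).add (hsum k))
    have hsub : ∀ x, H j x - H k x = cosSeries (fun n => s n * ρ j ^ n - s n * ρ k ^ n) x := by
      intro x
      refine ((hasSum_cosSeries (hsum j) x).sub (hasSum_cosSeries (hsum k) x)).unique ?_
      simp_rw [← sub_mul]
      exact hasSum_cosSeries hc x
    rw [← ofReal_integral_eq_lintegral_ofReal]
    · refine ENNReal.ofReal_le_ofReal ?_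
      rw [hμ, ← integral_Ioc_eq_integral_Ioo, ← intervalIntegral.integral_of_le Real.pi_pos.le]
      simp_rw [hsub]
      rw [integral_cosSeries_sq hc (by simp [s0]), he]
      simp only
      rw [← mul_add, ← Summable.tsum_add (hesum j) (hesum k)]
      refine mul_le_mul_of_nonneg_left ?_ (by positivity)
      -- For $x=1-\rho_j^n$ and $y=1-\rho_k^n$, both nonnegative, $(x-y)^2\le x^2+y^2$.
      have hle : ∀ n, (s n * ρ j ^ n - s n * ρ k ^ n) ^ 2
          ≤ s n ^ 2 * (1 - ρ j ^ n) ^ 2 + s n ^ 2 * (1 - ρ k ^ n) ^ 2 := by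
        intro n
        rw [← mul_sub, mul_pow, ← mul_add]
        refine mul_le_mul_of_nonneg_left ?_ (sq_nonneg _)
        nlinarith [mul_nonneg (sub_nonneg.2 (hp1 j n)) (sub_nonneg.2 (hp1 k n))]
      exact Summable.tsum_le_tsum hle (Summable.of_nonneg_of_le (fun n => sq_nonneg _) hle
        ((hesum j).add (hesum k))) ((hesum j).add (hesum k))
    · exact ((((hHc j).sub (hHc k)).pow 2).integrableOn_Icc).mono_set Set.Ioo_subset_Icc_self
    · exact ae_of_all _ fun x => sq_nonneg _
  -- Let $j\to\infty$ in `hdiff`: pointwise convergence is thereby upgraded to $L^2$ convergence.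
  have hfatou : ∀ k, ∫⁻ x, ENNReal.ofReal ((h x - H k x) ^ 2) ∂μ ≤ ENNReal.ofReal (e k) := by
    intro k
    calc ∫⁻ x, ENNReal.ofReal ((h x - H k x) ^ 2) ∂μ
        = ∫⁻ x, liminf (fun j => ENNReal.ofReal ((H j x - H k x) ^ 2)) atTop ∂μ := by
          refine lintegral_congr_ae ?_
          filter_upwards [hHh] with x hx
          exact (((ENNReal.continuous_ofReal.tendsto _).comp
            ((hx.sub_const (H k x)).pow 2)).liminf_eq).symm
      _ ≤ liminf (fun j => ∫⁻ x, ENNReal.ofReal ((H j x - H k x) ^ 2) ∂μ) atTop :=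
          lintegral_liminf_le fun j => by
            have := hHc j
            have := hHc k
            exact ENNReal.measurable_ofReal.comp (Continuous.measurable (by fun_prop))
      _ ≤ liminf (fun j => ENNReal.ofReal (e j + e k)) atTop :=
          liminf_le_liminf (Eventually.of_forall fun j => hdiff j k)
      _ = ENNReal.ofReal (e k) := by
          refine ((ENNReal.continuous_ofReal.tendsto _).comp ?_).liminf_eq
          simpa using het.add_const (e k)
  have hsqI : ∀ k, Integrable (fun x => (h x - H k x) ^ 2) μ := by
    intro k
    refine ⟨(hhm.sub (hHc k).aestronglyMeasurable).pow 2, ?_⟩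
    rw [hasFiniteIntegral_iff_ofReal (ae_of_all _ fun x => sq_nonneg _)]
    exact (hfatou k).trans_lt ENNReal.ofReal_lt_top
  have hsqle : ∀ k, ∫ x, (h x - H k x) ^ 2 ∂μ ≤ e k := by
    intro k
    have := hfatou k
    rw [← ofReal_integral_eq_lintegral_ofReal (hsqI k) (ae_of_all _ fun x => sq_nonneg _)] at this
    exact (ENNReal.ofReal_le_ofReal_iff (mul_nonneg (by positivity)
      (tsum_nonneg fun n => by positivity))).1 this
  have hfin : IsFiniteMeasure μ := by rw [hμ]; infer_instance
  have hdI : ∀ k, Integrable (fun x => h x - H k x) μ := by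
    intro k
    refine Integrable.mono' ((integrable_const (1 : ℝ)).add (hsqI k))
      (hhm.sub (hHc k).aestronglyMeasurable) (ae_of_all _ fun x => ?_)
    simp only [Pi.add_apply, Real.norm_eq_abs]
    nlinarith [sq_abs (h x - H k x), sq_nonneg (|h x - H k x| - 1)]
  have hHI : ∀ k, Integrable (H k) μ := fun k =>
    ((hHc k).integrableOn_Icc).mono_set Set.Ioo_subset_Icc_self
  have hhI : Integrable h μ := by
    refine ((hdI 0).add (hHI 0)).congr (ae_of_all _ fun x => ?_)
    simp
  have hconv : ∀ g : ℝ → ℝ, ∫ x in (0 : ℝ)..Real.pi, g x = ∫ x, g x ∂μ := fun g => by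
    rw [intervalIntegral.integral_of_le Real.pi_pos.le, integral_Ioc_eq_integral_Ioo]
  refine ⟨(intervalIntegrable_iff_integrableOn_Ioo_of_le Real.pi_pos.le).2 hhI, fun n => ?_⟩
  have hmulI : ∀ {g : ℝ → ℝ}, Integrable g μ → Integrable (fun x => g x * Real.cos (n * x)) μ := by
    intro g hg
    refine hg.mono (hg.1.mul (Continuous.aestronglyMeasurable (by fun_prop)))
      (ae_of_all _ fun x => abs_mul_cos_le _ _)
  -- The bound $|d|\le\delta+d^2/\delta$ takes the place of Cauchy–Schwarz: the error is at most
  -- $\delta\pi+e_k/\delta$ plus a term that vanishes as $k\to\infty$.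
  have hmain : ∀ δ > 0, |(∫ x in (0 : ℝ)..Real.pi, h x * Real.cos (n * x)) - Real.pi / 2 * s n|
      ≤ δ * Real.pi := by
    intro δ hδ
    have hlim2 : Tendsto (fun k => δ * Real.pi + e k / δ + |Real.pi / 2 * s n * (1 - ρ k ^ n)|)
        atTop (𝓝 (δ * Real.pi)) := by
      have h1 : Tendsto (fun k => |Real.pi / 2 * s n * (1 - ρ k ^ n)|) atTop
          (𝓝 |Real.pi / 2 * s n * (1 - 1 ^ n)|) :=
        (((hρt.pow n).const_sub 1).const_mul _).abs
      have h2 := ((het.div_const δ).const_add (δ * Real.pi)).add h1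
      simpa using h2
    refine ge_of_tendsto hlim2 (Eventually.of_forall fun k => ?_)
    have hk : ∫ x in (0 : ℝ)..Real.pi, H k x * Real.cos (n * x) = Real.pi / 2 * (s n * ρ k ^ n) :=
      integral_cosSeries_mul_cos (hsum k) (by simp [s0]) n
    have hdec : (∫ x in (0 : ℝ)..Real.pi, h x * Real.cos (n * x)) - Real.pi / 2 * s n
        = (∫ x, (h x - H k x) * Real.cos (n * x) ∂μ) - Real.pi / 2 * s n * (1 - ρ k ^ n) := by
      simp_rw [sub_mul]
      rw [integral_sub (hmulI hhI) (hmulI (hHI k)), ← hconv, ← hconv, hk]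
      ring
    rw [hdec]
    refine (abs_sub _ _).trans (add_le_add ?_ le_rfl)
    calc |∫ x, (h x - H k x) * Real.cos (n * x) ∂μ|
        ≤ ∫ x, (δ + (h x - H k x) ^ 2 / δ) ∂μ := by
          refine (norm_integral_le_integral_norm _).trans (integral_mono (hmulI (hdI k)).norm
            ((integrable_const δ).add ((hsqI k).div_const δ)) fun x => ?_)
          refine (abs_mul_cos_le _ _).trans ?_
          have : δ + (h x - H k x) ^ 2 / δ - |h x - H k x|
              = ((δ - |h x - H k x|) ^ 2 + δ * |h x - H k x|) / δ := by
            rw [← sq_abs (h x - H k x)]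
            field_simp
            ring
          have h3 : 0 ≤ ((δ - |h x - H k x|) ^ 2 + δ * |h x - H k x|) / δ := by positivity
          simp only [Pi.add_apply]
          linarith
      _ = δ * Real.pi + (∫ x, (h x - H k x) ^ 2 ∂μ) / δ := by
          rw [integral_add (integrable_const δ) ((hsqI k).div_const δ), integral_div]
          simp [hμ, Real.pi_pos.le, mul_comm]
      _ ≤ δ * Real.pi + e k / δ := by
          gcongr
          exact hsqle k
  by_contra hne
  have hpos := abs_pos.2 (sub_ne_zero.2 hne)
  generalize |(∫ x in (0 : ℝ)..Real.pi, h x * Real.cos (n * x)) - Real.pi / 2 * s n| = X at *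
  have := hmain (X / (2 * Real.pi)) (by have := Real.pi_pos; positivity)
  have hpi := Real.pi_ne_zero
  field_simp at this
  linarith

/-! ### The Cauchy transform in the Joukowski coordinate -/

/-- The Joukowski parametrization of the complement of `[c - r, c + r]` by the punctured disc. -/
def joukowski (c r : ℝ) (w : ℂ) : ℂ := c + r * (w + w⁻¹) / 2

/-- The Cauchy transform of the density `f`. -/
def cauchyTransform (f : ℝ → ℝ) (Z : ℂ) : ℂ := ∫ u, (f u : ℂ) / (Z - u)

theorem integral_eq_integral_cos {c r : ℝ} (hr : 0 < r) {g : ℝ → ℂ}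
    (hg : ∀ u, u ∉ Set.Icc (c - r) (c + r) → g u = 0) :
    ∫ u, g u = ∫ φ in (0 : ℝ)..Real.pi, (r * Real.sin φ : ℝ) * g (c + r * Real.cos φ) := by
  have himg : (fun φ : ℝ => c + r * Real.cos φ) '' Set.Ioo 0 Real.pi = Set.Ioo (c - r) (c + r) := by
    ext u
    constructor
    · rintro ⟨φ, hφ, rfl⟩
      have h1 : Real.cos φ < 1 := by
        rw [← Real.cos_zero]
        exact Real.cos_lt_cos_of_nonneg_of_le_pi le_rfl hφ.2.le hφ.1
      have h2 : -1 < Real.cos φ := by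
        rw [← Real.cos_pi]
        exact Real.cos_lt_cos_of_nonneg_of_le_pi hφ.1.le le_rfl hφ.2
      constructor <;> nlinarith
    · intro hu
      have h1 : -1 < (u - c) / r := by rw [lt_div_iff₀ hr]; linarith [hu.1]
      have h2 : (u - c) / r < 1 := by rw [div_lt_iff₀ hr]; linarith [hu.2]
      refine ⟨Real.arccos ((u - c) / r), ⟨Real.arccos_pos.2 h2, ?_⟩, ?_⟩
      · exact lt_of_le_of_ne (Real.arccos_le_pi _) fun h => by
          rw [Real.arccos_eq_pi] at h; linarith
      · simp only [Real.cos_arccos h1.le h2.le]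
        field_simp
        ring
  rw [← setIntegral_eq_integral_of_forall_compl_eq_zero hg, integral_Icc_eq_integral_Ioo, ← himg,
    integral_image_eq_integral_abs_deriv_smul measurableSet_Ioo
      (f' := fun φ => -(r * Real.sin φ)),
    intervalIntegral.integral_of_le Real.pi_pos.le, integral_Ioc_eq_integral_Ioo]
  · refine setIntegral_congr_fun measurableSet_Ioo fun φ hφ => ?_
    have := Real.sin_pos_of_mem_Ioo hφ
    rw [abs_neg, abs_of_pos (by positivity), Complex.real_smul]
  · intro φ _
    have := ((Real.hasDerivAt_cos φ).const_mul r).const_add c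
    rw [mul_neg] at this
    exact this.hasDerivWithinAt
  · intro x hx y hy hxy
    refine Real.injOn_cos ⟨hx.1.le, hx.2.le⟩ ⟨hy.1.le, hy.2.le⟩ ?_
    simpa [hr.ne'] using hxy

theorem hasSum_of_forall_eq {g₁ g₂ : ℕ → ℂ} {a₁ a₂ : ℂ} (h : HasSum g₁ a₁) (hg : ∀ n, g₂ n = g₁ n)
    (ha : a₂ = a₁) : HasSum g₂ a₂ := by
  rwa [ha, funext hg]

/-- The denominator factors as $\frac{r}{2w}(1-we^{i\varphi})(1-we^{-i\varphi})$, and partial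
fractions give the difference of two geometric series. -/
theorem hasSum_joukowski_kernel {c r : ℝ} (hr : 0 < r) {w : ℂ} (hw0 : w ≠ 0) (hw : ‖w‖ < 1)
    (φ : ℝ) :
    HasSum (fun n : ℕ => 2 * (Real.sin (n * φ) : ℂ) * w ^ n)
      ((r * Real.sin φ : ℝ) / (joukowski c r w - (c + r * Real.cos φ : ℝ))) := by
  set e := Complex.exp (φ * Complex.I) with he
  set e' := Complex.exp (-φ * Complex.I) with he'
  have hee : e * e' = 1 := by rw [he, he', ← Complex.exp_add]; simp
  have hne : ‖e‖ = 1 := Complex.norm_exp_ofReal_mul_I φ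
  have hne' : ‖e'‖ = 1 := by
    rw [he', ← Complex.ofReal_neg]
    exact Complex.norm_exp_ofReal_mul_I (-φ)
  have h1 : ‖w * e‖ < 1 := by rw [norm_mul, hne, mul_one]; exact hw
  have h2 : ‖w * e'‖ < 1 := by rw [norm_mul, hne', mul_one]; exact hw
  have d1 : 1 - w * e ≠ 0 := fun h => by
    rw [← sub_eq_zero.1 h] at h1; simp at h1
  have d2 : 1 - w * e' ≠ 0 := fun h => by
    rw [← sub_eq_zero.1 h] at h2; simp at h2
  have hcos : (Real.cos φ : ℂ) = (e + e') / 2 := by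
    rw [Complex.ofReal_cos, Complex.cos]
  have hsin : (Real.sin φ : ℂ) = (e' - e) * Complex.I / 2 := by
    rw [Complex.ofReal_sin, Complex.sin]
  have hs := (((hasSum_geometric_of_norm_lt_one h2).sub
    (hasSum_geometric_of_norm_lt_one h1)).mul_right Complex.I)
  refine hasSum_of_forall_eq hs (fun n => ?_) ?_
  · rw [Complex.ofReal_sin, Complex.sin, mul_pow, mul_pow, he, he', ← Complex.exp_nat_mul,
      ← Complex.exp_nat_mul]
    push_cast
    rw [show (n : ℂ) * (-φ * Complex.I) = -(n * φ) * Complex.I by ring,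
      show (n : ℂ) * (φ * Complex.I) = (n * φ) * Complex.I by ring]
    ring
  · have hden : joukowski c r w - (c + r * Real.cos φ : ℝ)
        = r * ((1 - w * e) * (1 - w * e')) / (2 * w) := by
      push_cast [joukowski]
      rw [← Complex.ofReal_cos, hcos]
      field_simp
      linear_combination (-(r : ℂ) * w ^ 2) * hee
    have hr' : (r : ℂ) ≠ 0 := by exact_mod_cast hr.ne'
    rw [hden]
    have hp : w * e' - w * e = (1 - w * e) - (1 - w * e') := by ring
    generalize 1 - w * e = p at d1 hp ⊢
    generalize 1 - w * e' = p' at d2 hp ⊢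
    push_cast
    rw [← Complex.ofReal_sin, hsin]
    field_simp
    linear_combination hp

/-- The Jacobian $r\sin\varphi$ of $u=c+r\cos\varphi$ is the numerator in `hasSum_joukowski_kernel`;
that expansion is integrated term by term with the geometric majorant $2M\|w\|^n$. -/
theorem hasSum_cauchyTransform_joukowski {f : ℝ → ℝ} {c r M : ℝ} (hr : 0 < r) (hf : Measurable f)
    (hM : ∀ u, |f u| ≤ M) (hs : ∀ u, u ∉ Set.Icc (c - r) (c + r) → f u = 0) {w : ℂ}
    (hw0 : w ≠ 0) (hw : ‖w‖ < 1) :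
    HasSum (fun n : ℕ => 2 * (sineMoment (fun φ => f (c + r * Real.cos φ)) n : ℂ) * w ^ n)
      (cauchyTransform f (joukowski c r w)) := by
  rw [cauchyTransform, integral_eq_integral_cos hr (c := c) (by intro u hu; simp [hs u hu])]
  have hM0 : 0 ≤ M := (abs_nonneg _).trans (hM 0)
  have hfm : Measurable fun φ => f (c + r * Real.cos φ) := hf.comp (by fun_prop)
  have h := intervalIntegral.hasSum_integral_of_dominated_convergence (μ := volume)
    (a := 0) (b := Real.pi)
    (F := fun (n : ℕ) (φ : ℝ) =>
      ((f (c + r * Real.cos φ) * Real.sin (n * φ) : ℝ) : ℂ) * (2 * w ^ n))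
    (f := fun φ => ((r * Real.sin φ : ℝ) : ℂ) * ((f (c + r * Real.cos φ) : ℂ)
      / (joukowski c r w - ((c + r * Real.cos φ : ℝ) : ℂ))))
    (fun n _ => M * (2 * ‖w‖ ^ n)) (fun n => ?_) (fun n => ae_of_all _ fun φ _ => ?_)
    (ae_of_all _ fun φ _ => ?_) ?_ (ae_of_all _ fun φ _ => ?_)
  · refine hasSum_of_forall_eq h (fun n => ?_) rfl
    rw [intervalIntegral.integral_mul_const, intervalIntegral.integral_ofReal, sineMoment]
    ring
  · exact ((Complex.measurable_ofReal.comp (hfm.mul (by fun_prop))).mul_const _).aestronglyMeasurable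
  · rw [norm_mul, norm_mul, norm_pow, Complex.norm_real, Complex.norm_two, norm_mul]
    gcongr
    calc ‖f (c + r * Real.cos φ)‖ * ‖Real.sin (n * φ)‖ ≤ M * 1 :=
          mul_le_mul (hM _) (Real.abs_sin_le_one _) (abs_nonneg _) hM0
      _ = M := mul_one M
  · exact ((summable_geometric_of_lt_one (norm_nonneg w) hw).mul_left 2).mul_left M
  · exact intervalIntegrable_const
  · have := (hasSum_joukowski_kernel (c := c) hr hw0 hw φ).mul_left (f (c + r * Real.cos φ) : ℂ)
    refine hasSum_of_forall_eq this (fun n => ?_) ?_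
    · push_cast
      ring
    · ring

/-! ### Principal values as limits of conjugate Poisson integrals -/

/-- `v` is the principal value at `z` of `∫ f u / (z - u)` over the line. -/
def HasPV (f : ℝ → ℝ) (z v : ℝ) : Prop :=
  Tendsto (fun ε : ℝ => ∫ u in {u : ℝ | ε < |u - z|}, f u / (z - u)) (𝓝[>] 0) (𝓝 v)

/-- The weight $2x/(1+x^2)^2$ is a probability density on $(0,\infty)$. Averaging the truncations at
distance $yx$ against it produces the conjugate Poisson kernel at height $y$. -/
theorem hasDerivAt_poissonWeight (x : ℝ) :
    HasDerivAt (fun x : ℝ => -(1 + x ^ 2)⁻¹) (2 * x / (1 + x ^ 2) ^ 2) x := by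
  have h : HasDerivAt (fun x : ℝ => 1 + x ^ 2) (2 * x) x := by
    simpa using ((hasDerivAt_id x).pow 2).const_add 1
  exact (h.fun_inv (by positivity)).fun_neg.congr_deriv (by ring)

theorem tendsto_poissonWeight : Tendsto (fun x : ℝ => -(1 + x ^ 2)⁻¹) atTop (𝓝 0) := by
  have h : Tendsto (fun x : ℝ => 1 + x ^ 2) atTop atTop :=
    tendsto_atTop_add_const_left _ _ (tendsto_pow_atTop two_ne_zero)
  simpa using h.inv_tendsto_atTop.neg

theorem integrableOn_poissonWeight :
    IntegrableOn (fun x : ℝ => 2 * x / (1 + x ^ 2) ^ 2) (Set.Ioi 0) :=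
  integrableOn_Ioi_deriv_of_nonneg' (fun x _ => hasDerivAt_poissonWeight x)
    (fun x hx => by have : 0 < x := hx; positivity) tendsto_poissonWeight

theorem integral_poissonWeight : ∫ x in Set.Ioi (0 : ℝ), 2 * x / (1 + x ^ 2) ^ 2 = 1 := by
  rw [integral_Ioi_of_hasDerivAt_of_nonneg' (fun x _ => hasDerivAt_poissonWeight x)
    (fun x hx => by have : 0 < x := hx; positivity) tendsto_poissonWeight]
  simp

/-- With $t=|u-z|/y$ the value is $(u-z)^2/((u-z)^2+y^2)$, the factor that turns $1/(z-u)$ into the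
conjugate Poisson kernel. -/
theorem integral_poissonWeight_Ioo {t : ℝ} (ht : 0 ≤ t) :
    ∫ x in Set.Ioo 0 t, 2 * x / (1 + x ^ 2) ^ 2 = t ^ 2 / (1 + t ^ 2) := by
  have hc : Continuous fun x : ℝ => 2 * x / (1 + x ^ 2) ^ 2 :=
    Continuous.div (by fun_prop) (by fun_prop) fun x => by positivity
  rw [← integral_Ioc_eq_integral_Ioo, ← intervalIntegral.integral_of_le ht,
    intervalIntegral.integral_eq_sub_of_hasDerivAt (fun x _ => hasDerivAt_poissonWeight x)
      (hc.intervalIntegrable _ _)]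
  field_simp
  ring

/-- The integrand whose integral over `x` is a smooth truncation and whose integral over `u` is a
sharp truncation of the Cauchy kernel. -/
def truncationKernel (f : ℝ → ℝ) (z y : ℝ) (q : ℝ × ℝ) : ℝ :=
  2 * q.1 / (1 + q.1 ^ 2) ^ 2 * {u : ℝ | y * q.1 < |u - z|}.indicator (fun u => f u / (z - u)) q.2

/-- Where the truncation is active, $|z-u|>yx$, and the zero of the weight at $x=0$ cancels the
resulting factor $1/x$. -/
theorem integrable_truncationKernel {f : ℝ → ℝ} (hf : Measurable f) (hfi : Integrable f)
    (z : ℝ) {y : ℝ} (hy : 0 < y) :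
    Integrable (truncationKernel f z y) ((volume.restrict (Set.Ioi 0)).prod volume) := by
  have hb : Integrable (fun q : ℝ × ℝ => (2 / y * (1 + q.1 ^ 2)⁻¹) * ‖f q.2‖)
      ((volume.restrict (Set.Ioi (0 : ℝ))).prod volume) :=
    Integrable.mul_prod (f := fun x : ℝ => 2 / y * (1 + x ^ 2)⁻¹) (g := fun u => ‖f u‖)
      ((integrable_inv_one_add_sq.const_mul _).restrict) hfi.norm
  refine hb.mono' ?_ ?_
  · refine Measurable.aestronglyMeasurable ?_
    have : truncationKernel f z y = fun q : ℝ × ℝ => 2 * q.1 / (1 + q.1 ^ 2) ^ 2 *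
        {q : ℝ × ℝ | y * q.1 < |q.2 - z|}.indicator (fun q => f q.2 / (z - q.2)) q := by
      funext q
      simp [truncationKernel, Set.indicator]
    rw [this]
    refine Measurable.mul (by fun_prop) (Measurable.indicator (by fun_prop) ?_)
    exact measurableSet_lt (by fun_prop) (by fun_prop)
  · have : ∀ᵐ q : ℝ × ℝ ∂((volume.restrict (Set.Ioi (0 : ℝ))).prod volume), 0 < q.1 :=
      Measure.quasiMeasurePreserving_fst.ae (ae_restrict_mem measurableSet_Ioi)
    filter_upwards [this] with q hq
    have hq2 : 0 < 1 + q.1 ^ 2 := by positivity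
    by_cases h : y * q.1 < |q.2 - z|
    · have hmem : q.2 ∈ {u : ℝ | y * q.1 < |u - z|} := h
      rw [truncationKernel, Set.indicator_of_mem hmem, norm_mul, norm_div, norm_div,
        Real.norm_of_nonneg (by positivity), Real.norm_of_nonneg (by positivity),
        Real.norm_eq_abs (z - q.2), abs_sub_comm]
      calc 2 * q.1 / (1 + q.1 ^ 2) ^ 2 * (‖f q.2‖ / |q.2 - z|)
          ≤ 2 * q.1 / (1 + q.1 ^ 2) ^ 2 * (‖f q.2‖ / (y * q.1)) := by gcongr
        _ = 2 / y * ((1 + q.1 ^ 2)⁻¹ * (1 + q.1 ^ 2)⁻¹) * ‖f q.2‖ := by field_simp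
        _ ≤ 2 / y * (1 * (1 + q.1 ^ 2)⁻¹) * ‖f q.2‖ := by
          gcongr
          exact inv_le_one_of_one_le₀ (by nlinarith [sq_nonneg q.1])
        _ = _ := by ring
    · have hmem : q.2 ∉ {u : ℝ | y * q.1 < |u - z|} := h
      rw [truncationKernel, Set.indicator_of_notMem hmem, mul_zero, norm_zero]
      positivity

theorem measurableSet_truncation (ε z : ℝ) : MeasurableSet {u : ℝ | ε < |u - z|} :=
  measurableSet_lt measurable_const (by fun_prop)

/-- The conjugate Poisson integral is an average of sharp truncations. -/
theorem integral_conjPoisson_eq {f : ℝ → ℝ} (hf : Measurable f) (hfi : Integrable f)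
    (z : ℝ) {y : ℝ} (hy : 0 < y) :
    ∫ u, f u * (z - u) / ((z - u) ^ 2 + y ^ 2)
      = ∫ x in Set.Ioi (0 : ℝ), 2 * x / (1 + x ^ 2) ^ 2 *
        ∫ u in {u : ℝ | y * x < |u - z|}, f u / (z - u) := by
  have h := integral_integral_swap (μ := volume.restrict (Set.Ioi (0 : ℝ))) (ν := volume)
    (f := fun x u => truncationKernel f z y (x, u)) (integrable_truncationKernel hf hfi z hy)
  have h1 : ∀ x : ℝ, ∫ u, truncationKernel f z y (x, u) = 2 * x / (1 + x ^ 2) ^ 2 *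
      ∫ u in {u : ℝ | y * x < |u - z|}, f u / (z - u) := by
    intro x
    simp only [truncationKernel]
    rw [integral_const_mul, integral_indicator (measurableSet_truncation _ _)]
  simp_rw [h1] at h
  rw [h]
  refine integral_congr_ae ?_
  filter_upwards [(measure_eq_zero_iff_ae_notMem).1 (measure_singleton (μ := volume) z)] with u hu
  have hzu : z - u ≠ 0 := fun h => hu (by simp; linarith)
  have h2 : ∀ x ∈ Set.Ioi (0 : ℝ), truncationKernel f z y (x, u)
      = f u / (z - u) * (Set.Ioo 0 (|u - z| / y)).indicator
        (fun x : ℝ => 2 * x / (1 + x ^ 2) ^ 2) x := by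
    intro x hx
    have hx : 0 < x := hx
    by_cases hc : y * x < |u - z|
    · have m1 : u ∈ {u : ℝ | y * x < |u - z|} := hc
      have m2 : x ∈ Set.Ioo 0 (|u - z| / y) := ⟨hx, by rw [lt_div_iff₀ hy]; linarith⟩
      simp only [truncationKernel, Set.indicator_of_mem m1, Set.indicator_of_mem m2]
      ring
    · have m1 : u ∉ {u : ℝ | y * x < |u - z|} := hc
      have m2 : x ∉ Set.Ioo 0 (|u - z| / y) := fun h => hc (by
        have := h.2
        rw [lt_div_iff₀ hy] at this
        linarith)
      simp only [truncationKernel, Set.indicator_of_notMem m1, Set.indicator_of_notMem m2, mul_zero]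
  rw [setIntegral_congr_fun measurableSet_Ioi h2, integral_const_mul,
    setIntegral_indicator measurableSet_Ioo,
    Set.inter_eq_self_of_subset_right Set.Ioo_subset_Ioi_self,
    integral_poissonWeight_Ioo (by positivity), div_pow, sq_abs, ← neg_sub z u, neg_sq]
  field_simp
  ring

/-- An Abelian theorem: averages of a convergent family have the same limit. Dominated convergence
applies because the truncations are uniformly bounded, for small $\varepsilon$ by convergence and
for $\varepsilon\ge\delta$ by $\|f\|_1/\delta$. -/
theorem tendsto_conjPoisson {f : ℝ → ℝ} (hf : Measurable f) (hfi : Integrable f) {z v : ℝ}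
    (hv : HasPV f z v) :
    Tendsto (fun y : ℝ => ∫ u, f u * (z - u) / ((z - u) ^ 2 + y ^ 2)) (𝓝[>] 0) (𝓝 v) := by
  set T : ℝ → ℝ := fun ε => ∫ u in {u : ℝ | ε < |u - z|}, f u / (z - u) with hT
  obtain ⟨K, hK⟩ : ∃ K, ∀ ε > 0, |T ε| ≤ K := by
    have h1 : ∀ᶠ ε in 𝓝[>] (0 : ℝ), |T ε| < |v| + 1 := (hv.abs).eventually_lt_const (by linarith)
    obtain ⟨δ, hδ, hδ'⟩ := mem_nhdsGT_iff_exists_Ioo_subset.1 h1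
    have hδ : 0 < δ := hδ
    refine ⟨max (|v| + 1) ((∫ u, ‖f u‖) / δ), fun ε hε => ?_⟩
    rcases lt_or_ge ε δ with h | h
    · exact (le_of_lt (hδ' ⟨hε, h⟩)).trans (le_max_left _ _)
    · refine le_trans ?_ (le_max_right _ _)
      rw [← integral_div]
      rw [← Real.norm_eq_abs, hT]
      refine (norm_integral_le_integral_norm _).trans ?_
      refine (integral_mono_of_nonneg (ae_of_all _ fun u => norm_nonneg _)
        ((hfi.norm.div_const δ).restrict) ?_).trans
        (setIntegral_le_integral (hfi.norm.div_const δ) (ae_of_all _ fun u => by positivity))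
      filter_upwards [ae_restrict_mem (measurableSet_truncation ε z)] with u hu
      have hu : ε < |u - z| := hu
      rw [norm_div, Real.norm_eq_abs (z - u), abs_sub_comm]
      have : δ ≤ |u - z| := h.trans hu.le
      gcongr
  have hmain : Tendsto (fun y : ℝ => ∫ x in Set.Ioi (0 : ℝ), 2 * x / (1 + x ^ 2) ^ 2 * T (y * x))
      (𝓝[>] 0) (𝓝 (∫ x in Set.Ioi (0 : ℝ), 2 * x / (1 + x ^ 2) ^ 2 * v)) := by
    refine tendsto_integral_filter_of_dominated_convergence
      (fun x => 2 * x / (1 + x ^ 2) ^ 2 * K) ?_ ?_ (integrableOn_poissonWeight.mul_const K) ?_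
    · filter_upwards [self_mem_nhdsWithin] with y hy
      have h := (integrable_truncationKernel hf hfi z hy).integral_prod_left.1
      refine h.congr (ae_of_all _ fun x => ?_)
      simp only [truncationKernel]
      rw [integral_const_mul, integral_indicator (measurableSet_truncation _ _)]
    · filter_upwards [self_mem_nhdsWithin] with y hy
      filter_upwards [ae_restrict_mem measurableSet_Ioi] with x hx
      have hx : 0 < x := hx
      have hy : 0 < y := hy
      rw [norm_mul, Real.norm_of_nonneg (by positivity)]
      exact mul_le_mul_of_nonneg_left (hK _ (by positivity)) (by positivity)
    · filter_upwards [ae_restrict_mem measurableSet_Ioi] with x hx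
      have hx : 0 < x := hx
      refine Tendsto.const_mul _ (hv.comp ?_)
      refine tendsto_nhdsWithin_iff.2 ⟨?_, ?_⟩
      · have : Tendsto (fun y : ℝ => y * x) (𝓝 0) (𝓝 (0 * x)) :=
          (continuous_id.mul continuous_const).tendsto 0
        rw [zero_mul] at this
        exact this.mono_left nhdsWithin_le_nhds
      · filter_upwards [self_mem_nhdsWithin] with y hy
        exact mul_pos hy hx
  rw [integral_mul_const, integral_poissonWeight, one_mul] at hmain
  refine hmain.congr' ?_
  filter_upwards [self_mem_nhdsWithin] with y hy
  exact (integral_conjPoisson_eq hf hfi z hy).symm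

/-! ### From vertical approach to radial approach in the Joukowski coordinate -/

theorem poissonKernel_eq (x u : ℝ) {y : ℝ} (hy : 0 < y) :
    ((x - u) ^ 2 + y ^ 2)⁻¹ = (y ^ 2)⁻¹ * (1 + ((x - u) / y) ^ 2)⁻¹ := by
  rw [← mul_inv]
  congr 1
  field_simp
  ring

theorem integrable_poissonKernel (x : ℝ) {y : ℝ} (hy : 0 < y) :
    Integrable fun u : ℝ => ((x - u) ^ 2 + y ^ 2)⁻¹ := by
  simp_rw [poissonKernel_eq x _ hy]
  exact ((integrable_inv_one_add_sq.comp_div hy.ne').comp_sub_left x).const_mul _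

theorem integral_poissonKernel (x : ℝ) {y : ℝ} (hy : 0 < y) :
    ∫ u : ℝ, ((x - u) ^ 2 + y ^ 2)⁻¹ = Real.pi / y := by
  simp_rw [poissonKernel_eq x _ hy]
  rw [integral_const_mul, integral_sub_left_eq_self (fun u : ℝ => (1 + (u / y) ^ 2)⁻¹),
    Measure.integral_comp_div (fun u : ℝ => (1 + u ^ 2)⁻¹), integral_univ_inv_one_add_sq,
    smul_eq_mul, abs_of_pos hy]
  field_simp

theorem norm_sq_sub_ofReal (x y u : ℝ) :
    ‖(x + y * Complex.I : ℂ) - u‖ ^ 2 = (x - u) ^ 2 + y ^ 2 := by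
  rw [← Complex.normSq_eq_norm_sq, Complex.normSq_apply]
  simp
  ring

theorem le_norm_sub_ofReal (x u y : ℝ) :
    y ≤ ‖(x + y * Complex.I : ℂ) - u‖ := by
  have h := norm_sq_sub_ofReal x y u
  refine le_of_sq_le_sq ?_ (norm_nonneg _)
  rw [h]
  nlinarith [sq_nonneg (x - u)]

theorem integrable_div_sub {f : ℝ → ℝ} (hf : Measurable f) (hfi : Integrable f) (x : ℝ) {y : ℝ}
    (hy : 0 < y) : Integrable fun u : ℝ => (f u : ℂ) / ((x + y * Complex.I : ℂ) - u) := by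
  refine (hfi.norm.div_const y).mono' (Measurable.aestronglyMeasurable (by fun_prop))
    (ae_of_all _ fun u => ?_)
  rw [norm_div, Complex.norm_real]
  have := le_norm_sub_ofReal x u y
  gcongr

/-- With $p,p'$ the two denominators, $\frac1p-\frac1{p'}=\frac{p'-p}{pp'}$ and
$\frac1{|pp'|}\le\frac12(|p|^{-2}+|p'|^{-2})$; both squares are Poisson kernels of integral $\pi/y$.
The bound controls a horizontal displacement that is small compared with the height. -/
theorem norm_cauchyTransform_sub_le {f : ℝ → ℝ} (hf : Measurable f) (hfi : Integrable f) {M : ℝ}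
    (hM : ∀ u, |f u| ≤ M) (x z : ℝ) {y : ℝ} (hy : 0 < y) :
    ‖cauchyTransform f (x + y * Complex.I) - cauchyTransform f (z + y * Complex.I)‖
      ≤ M * |x - z| * (Real.pi / y) := by
  have hM0 : 0 ≤ M := (abs_nonneg _).trans (hM 0)
  rw [cauchyTransform, cauchyTransform,
    ← integral_sub (integrable_div_sub hf hfi x hy) (integrable_div_sub hf hfi z hy)]
  have hb : Integrable fun u : ℝ => M * |x - z| *
      ((((x - u) ^ 2 + y ^ 2)⁻¹ + ((z - u) ^ 2 + y ^ 2)⁻¹) / 2) :=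
    (((integrable_poissonKernel x hy).add (integrable_poissonKernel z hy)).div_const 2).const_mul _
  refine (norm_integral_le_of_norm_le hb (ae_of_all _ fun u => ?_)).trans (le_of_eq ?_)
  · rw [← norm_sq_sub_ofReal x y u, ← norm_sq_sub_ofReal z y u]
    have h1 := hy.trans_le (le_norm_sub_ofReal x u y)
    have h2 := hy.trans_le (le_norm_sub_ofReal z u y)
    have hd : ((z + y * Complex.I : ℂ) - u) - ((x + y * Complex.I : ℂ) - u)
        = ((z - x : ℝ) : ℂ) := by push_cast; ring
    generalize ((x + y * Complex.I : ℂ) - u) = p at *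
    generalize ((z + y * Complex.I : ℂ) - u) = p' at *
    rw [div_sub_div _ _ (norm_pos_iff.1 h1) (norm_pos_iff.1 h2), mul_comm p, ← mul_sub, hd,
      norm_div, norm_mul, norm_mul, Complex.norm_real, Complex.norm_real, Real.norm_eq_abs,
      Real.norm_eq_abs, abs_sub_comm z x, div_eq_mul_inv]
    refine mul_le_mul (mul_le_mul_of_nonneg_right (hM u) (abs_nonneg _)) ?_ (by positivity)
      (by positivity)
    rw [mul_inv, ← inv_pow, ← inv_pow]
    nlinarith [sq_nonneg (‖p‖⁻¹ - ‖p'‖⁻¹)]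
  · rw [integral_const_mul, integral_div,
      integral_add (integrable_poissonKernel x hy) (integrable_poissonKernel z hy),
      integral_poissonKernel x hy, integral_poissonKernel z hy]
    ring

theorem re_cauchyTransform {f : ℝ → ℝ} (hf : Measurable f) (hfi : Integrable f) (z : ℝ) {y : ℝ}
    (hy : 0 < y) : (cauchyTransform f (z + y * Complex.I)).re
      = ∫ u, f u * (z - u) / ((z - u) ^ 2 + y ^ 2) := by
  rw [cauchyTransform]
  refine (integral_re (integrable_div_sub hf hfi z hy)).symm.trans ?_
  refine integral_congr_ae (ae_of_all _ fun u => ?_)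
  simp only [RCLike.re_eq_complex_re]
  rw [div_eq_mul_inv, Complex.re_ofReal_mul, Complex.inv_re, Complex.normSq_eq_norm_sq,
    norm_sq_sub_ofReal]
  simp
  ring

/-- The sign in $e^{-i\theta}$ is chosen so that for $0<\rho<1$ and $0<\theta<\pi$ the image lies in
the upper half-plane. -/
theorem joukowski_polar (c r θ : ℝ) {ρ : ℝ} (hρ : ρ ≠ 0) :
    joukowski c r (ρ * Complex.exp (-(θ * Complex.I)))
      = ((c + r * ((ρ + ρ⁻¹) / 2) * Real.cos θ : ℝ) : ℂ)
        + ((r * ((ρ⁻¹ - ρ) / 2) * Real.sin θ : ℝ) : ℂ) * Complex.I := by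
  have hρ' : (ρ : ℂ) ≠ 0 := by exact_mod_cast hρ
  rw [joukowski, mul_inv, ← Complex.exp_neg, neg_neg, Complex.exp_mul_I, ← neg_mul,
    Complex.exp_mul_I, Complex.cos_neg, Complex.sin_neg]
  push_cast
  ring

theorem norm_polar (θ ρ : ℝ) (hρ : 0 ≤ ρ) : ‖(ρ * Complex.exp (-(θ * Complex.I)) : ℂ)‖ = ρ := by
  rw [norm_mul, Complex.norm_exp]
  simp [abs_of_nonneg hρ]

theorem eventually_Ioo_zero_one : ∀ᶠ ρ : ℝ in 𝓝[<] 1, ρ ∈ Set.Ioo (0 : ℝ) 1 :=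
  Ioo_mem_nhdsLT zero_lt_one

/-- The principal value at an interior point is a radial limit in the Joukowski coordinate. -/
theorem tendsto_re_cauchyTransform_joukowski {f : ℝ → ℝ} (hf : Measurable f) (hfi : Integrable f)
    {M : ℝ} (hM : ∀ u, |f u| ≤ M) {c r θ v : ℝ} (hr : 0 < r) (hθ : θ ∈ Set.Ioo 0 Real.pi)
    (hv : HasPV f (c + r * Real.cos θ) v) :
    Tendsto (fun ρ : ℝ =>
      (cauchyTransform f (joukowski c r (ρ * Complex.exp (-(θ * Complex.I))))).re)
      (𝓝[<] 1) (𝓝 v) := by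
  have hsin := Real.sin_pos_of_mem_Ioo hθ
  set y : ℝ → ℝ := fun ρ => r * ((ρ⁻¹ - ρ) / 2) * Real.sin θ with hy
  set z := c + r * Real.cos θ with hz
  have hy0 : ∀ ρ ∈ Set.Ioo (0 : ℝ) 1, 0 < y ρ := by
    intro ρ hρ
    have : 1 < ρ⁻¹ := (one_lt_inv₀ hρ.1).2 hρ.2
    have : 0 < ρ⁻¹ - ρ := by linarith [hρ.2]
    positivity
  have hyt : Tendsto y (𝓝[<] 1) (𝓝[>] 0) := by
    refine tendsto_nhdsWithin_iff.2 ⟨?_, ?_⟩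
    · have : ContinuousAt y 1 := by
        refine ContinuousAt.mul (ContinuousAt.mul continuousAt_const (ContinuousAt.div_const
          (ContinuousAt.sub (continuousAt_inv₀ one_ne_zero) continuousAt_id) _)) continuousAt_const
      have h := this.tendsto
      simp only [hy, inv_one, sub_self, zero_div, mul_zero, zero_mul] at h
      exact h.mono_left nhdsWithin_le_nhds
    · filter_upwards [eventually_Ioo_zero_one] with ρ hρ using hy0 ρ hρ
  have h1 := (tendsto_conjPoisson hf hfi hv).comp hyt
  -- The radial path strays horizontally from $z$ by $O((1-\rho)^2)$ at height of order $1-\rho$;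
  -- the displayed function is $M\pi$ times the ratio of the two.
  have hlim : Tendsto (fun ρ : ℝ => M * |Real.cos θ| * Real.pi / Real.sin θ * ((1 - ρ) / (1 + ρ)))
      (𝓝[<] 1) (𝓝 0) := by
    have : ContinuousAt (fun ρ : ℝ =>
        M * |Real.cos θ| * Real.pi / Real.sin θ * ((1 - ρ) / (1 + ρ))) 1 :=
      ContinuousAt.mul continuousAt_const (ContinuousAt.div (by fun_prop) (by fun_prop)
        (by norm_num))
    have h := this.tendsto
    simp only [sub_self, zero_div, mul_zero] at h
    exact h.mono_left nhdsWithin_le_nhds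
  have h2 : Tendsto (fun ρ : ℝ =>
      (cauchyTransform f (joukowski c r (ρ * Complex.exp (-(θ * Complex.I))))).re
        - ∫ u, f u * (z - u) / ((z - u) ^ 2 + (y ρ) ^ 2)) (𝓝[<] 1) (𝓝 0) := by
    refine squeeze_zero_norm' ?_ hlim
    filter_upwards [eventually_Ioo_zero_one] with ρ hρ
    rw [joukowski_polar c r θ hρ.1.ne', ← re_cauchyTransform hf hfi z (hy0 ρ hρ), ← Complex.sub_re]
    refine (Complex.abs_re_le_norm _).trans ((norm_cauchyTransform_sub_le hf hfi hM _ z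
      (hy0 ρ hρ)).trans (le_of_eq ?_))
    have hρ0 := hρ.1
    have e1 : c + r * ((ρ + ρ⁻¹) / 2) * Real.cos θ - z
        = Real.cos θ * (r * (1 - ρ) ^ 2 / (2 * ρ)) := by
      rw [hz]; field_simp; ring
    have e2 : y ρ = r * Real.sin θ * ((1 - ρ) * (1 + ρ)) / (2 * ρ) := by
      simp only [hy]; field_simp; ring
    rw [e1, e2, abs_mul, abs_of_nonneg (a := r * (1 - ρ) ^ 2 / (2 * ρ)) (by positivity)]
    have : 0 < 1 - ρ := sub_pos.2 hρ.2
    field_simp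
  have h3 := h2.add h1
  rw [zero_add] at h3
  refine h3.congr fun ρ => ?_
  simp [Function.comp]

/-! ### The airfoil equation in terms of sine moments -/

/-- The real part of the power series at $w=\rho e^{-i\theta}$ is an Abel mean, so radial limits
fall under `integral_mul_cos_of_tendsto_abel`. -/
theorem cosSeries_eq_re_cauchyTransform {f : ℝ → ℝ} (hf : Measurable f) {M : ℝ}
    (hM : ∀ u, |f u| ≤ M) {c r : ℝ} (hr : 0 < r)
    (hs : ∀ u, u ∉ Set.Icc (c - r) (c + r) → f u = 0) (θ : ℝ) {ρ : ℝ} (hρ : ρ ∈ Set.Ioo (0 : ℝ) 1) :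
    cosSeries (fun n => 2 * sineMoment (fun φ => f (c + r * Real.cos φ)) n * ρ ^ n) θ
      = (cauchyTransform f (joukowski c r (ρ * Complex.exp (-(θ * Complex.I))))).re := by
  have h := hasSum_cauchyTransform_joukowski hr hf hM hs
    (w := ρ * Complex.exp (-(θ * Complex.I)))
    (mul_ne_zero (by exact_mod_cast hρ.1.ne') (Complex.exp_ne_zero _))
    (by rw [norm_polar θ ρ hρ.1.le]; exact hρ.2)
  have h2 := (Complex.hasSum_re h).tsum_eq
  rw [← h2, cosSeries]
  refine tsum_congr fun n => ?_
  have e : (ρ * Complex.exp (-(θ * Complex.I)) : ℂ) ^ n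
      = ((ρ ^ n : ℝ) : ℂ) * Complex.exp ((-(n * θ) : ℝ) * Complex.I) := by
    rw [mul_pow, ← Complex.exp_nat_mul]
    push_cast
    ring_nf
  rw [e]
  have e2 : (2 * (sineMoment (fun φ => f (c + r * Real.cos φ)) n : ℂ) *
      (((ρ ^ n : ℝ) : ℂ) * Complex.exp ((-(n * θ) : ℝ) * Complex.I)))
      = ((2 * sineMoment (fun φ => f (c + r * Real.cos φ)) n * ρ ^ n : ℝ) : ℂ) *
        Complex.exp ((-(n * θ) : ℝ) * Complex.I) := by push_cast; ring
  rw [e2, Complex.re_ofReal_mul, Complex.exp_ofReal_mul_I_re, Real.cos_neg]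

/-- The airfoil equation determines the sine moments of a bounded density. -/
theorem integral_pv_mul_cos {f h : ℝ → ℝ} (hf : Measurable f) {M : ℝ}
    (hM : ∀ u, |f u| ≤ M) {c r : ℝ} (hr : 0 < r)
    (hs : ∀ u, u ∉ Set.Icc (c - r) (c + r) → f u = 0)
    (hpv : ∀ z ∈ Set.Ioo (c - r) (c + r), HasPV f z (h z)) :
    IntervalIntegrable (fun θ => h (c + r * Real.cos θ)) volume 0 Real.pi ∧
      ∀ n : ℕ, ∫ θ in (0 : ℝ)..Real.pi, h (c + r * Real.cos θ) * Real.cos (n * θ)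
        = Real.pi * sineMoment (fun φ => f (c + r * Real.cos φ)) n := by
  have hfi : Integrable f := by
    rw [← integrableOn_iff_integrable_of_support_subset (s := Set.Icc (c - r) (c + r))
      (fun u hu => by_contra fun h => hu (hs u h))]
    exact Measure.integrableOn_of_bounded (M := M) (by simp) hf.aestronglyMeasurable
      (ae_of_all _ hM)
  have hsq := summable_sq_sineMoment (p := fun φ => f (c + r * Real.cos φ))
    (hf.comp (by fun_prop)) (fun x => hM _)
  have key := integral_mul_cos_of_tendsto_abel
    (s := fun n => 2 * sineMoment (fun φ => f (c + r * Real.cos φ)) n)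
    (h := fun θ => h (c + r * Real.cos θ))
    (by simp_rw [mul_pow]; exact hsq.mul_left _) (by simp [sineMoment]) (fun θ hθ => ?_)
  · refine ⟨key.1, fun n => ?_⟩
    rw [key.2 n]
    ring
  · have h1 : Real.cos θ < 1 := by
      rw [← Real.cos_zero]
      exact Real.cos_lt_cos_of_nonneg_of_le_pi le_rfl hθ.2.le hθ.1
    have h2 : -1 < Real.cos θ := by
      rw [← Real.cos_pi]
      exact Real.cos_lt_cos_of_nonneg_of_le_pi hθ.1.le le_rfl hθ.2
    refine (tendsto_re_cauchyTransform_joukowski hf hfi hM hr hθ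
      (hpv _ ⟨by nlinarith, by nlinarith⟩)).congr' ?_
    filter_upwards [eventually_Ioo_zero_one] with ρ hρ
    exact (cosSeries_eq_re_cauchyTransform hf hM hr hs θ hρ).symm

/-- A bounded density is determined by its sine moments. -/
theorem ae_eq_zero_of_sineMoment_cos {f : ℝ → ℝ} (hf : Measurable f) {M : ℝ}
    (hM : ∀ u, |f u| ≤ M) {c r : ℝ} (hr : 0 < r)
    (hs : ∀ u, u ∉ Set.Icc (c - r) (c + r) → f u = 0)
    (h0 : ∀ n, sineMoment (fun φ => f (c + r * Real.cos φ)) n = 0) : ∀ᵐ u, f u = 0 := by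
  have h1 := ae_eq_zero_of_sineMoment (p := fun φ => f (c + r * Real.cos φ))
    (hf.comp (by fun_prop)) (fun x => hM _) h0
  -- Changing variables in $\int|f|$ carries the conclusion from almost every $\varphi$ to almost
  -- every $u$.
  have h2 := integral_eq_integral_cos (c := c) hr (g := fun u => ((|f u| : ℝ) : ℂ))
    (fun u hu => by simp [hs u hu])
  have h3 : ∫ φ in (0 : ℝ)..Real.pi, ((r * Real.sin φ : ℝ) : ℂ) *
      ((|f (c + r * Real.cos φ)| : ℝ) : ℂ) = 0 := by
    rw [intervalIntegral.integral_of_le Real.pi_pos.le, integral_Ioc_eq_integral_Ioo]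
    refine integral_eq_zero_of_ae ?_
    filter_upwards [h1] with x hx
    simp [hx]
  rw [h3] at h2
  have h4 : ∫ u, |f u| = 0 := by
    have : ((∫ u, |f u| : ℝ) : ℂ) = 0 := by rw [← h2]; exact integral_ofReal.symm
    exact_mod_cast this
  have hfi : Integrable f := by
    rw [← integrableOn_iff_integrable_of_support_subset (s := Set.Icc (c - r) (c + r))
      (fun u hu => by_contra fun h => hu (hs u h))]
    exact Measure.integrableOn_of_bounded (M := M) (by simp) hf.aestronglyMeasurable
      (ae_of_all _ hM)
  filter_upwards [(integral_eq_zero_iff_of_nonneg (fun u => abs_nonneg _) hfi.abs).1 h4] with u hu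
  simpa using hu

/-! ### Existence of principal values under a Hölder condition, and end points -/

theorem integrable_indicator_inv_sqrt_abs :
    Integrable ((Set.Ioo (-1 : ℝ) 1).indicator fun t => (√|t|)⁻¹) := by
  have h1 : IntegrableOn (fun t : ℝ => (√t)⁻¹) (Set.Ioo 0 1) := by
    refine ((intervalIntegral.integrableOn_Ioo_rpow_iff (s := -(1 / 2)) zero_lt_one).2
      (by norm_num)).congr_fun (fun t ht => ?_) measurableSet_Ioo
    simp only
    rw [Real.rpow_neg ht.1.le, Real.sqrt_eq_rpow]
  have h2 := (integrable_indicator_iff measurableSet_Ioo).2 h1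
  refine (h2.add h2.comp_neg).congr (ae_of_all _ fun t => ?_)
  simp only [Pi.add_apply, Set.indicator, Set.mem_Ioo]
  rcases lt_trichotomy t 0 with ht | rfl | ht
  · have e1 : ¬(0 < t ∧ t < 1) := fun h => by linarith [h.1]
    have e2 : (0 < -t ∧ -t < 1) ↔ (-1 < t ∧ t < 1) :=
      ⟨fun h => ⟨by linarith [h.2], by linarith⟩, fun h => ⟨by linarith, by linarith [h.1]⟩⟩
    simp only [e1, e2, if_false, zero_add, abs_of_neg ht]
  · simp
  · have e1 : ¬(0 < -t ∧ -t < 1) := fun h => by linarith [h.1]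
    have e2 : (0 < t ∧ t < 1) ↔ (-1 < t ∧ t < 1) :=
      ⟨fun h => ⟨by linarith [h.1], h.2⟩, fun h => ⟨ht, h.2⟩⟩
    simp only [e1, e2, if_false, add_zero, abs_of_pos ht]

/-- The density with its value at `z` subtracted near `z`, divided by `z - u`. -/
def regularizedKernel (f : ℝ → ℝ) (z u : ℝ) : ℝ :=
  (f u - {u : ℝ | |u - z| < 1}.indicator (fun _ => f z) u) / (z - u)

theorem measurableSet_abs_sub_lt (z : ℝ) : MeasurableSet {u : ℝ | |u - z| < 1} :=
  measurableSet_lt (by fun_prop) measurable_const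

/-- Hölder continuity of exponent $1/2$ at $z$ leaves a singularity $|u-z|^{-1/2}$; away from $z$
the kernel is dominated by $|f|$. -/
theorem integrable_regularizedKernel {f : ℝ → ℝ} (hf : Measurable f) (hfi : Integrable f)
    {z C : ℝ} (hC : ∀ u, |u - z| < 1 → |f u - f z| ≤ C * √|u - z|) :
    Integrable (regularizedKernel f z) := by
  have hb := ((integrable_indicator_inv_sqrt_abs.comp_sub_right z).const_mul C).add hfi.norm
  refine hb.mono' (Measurable.aestronglyMeasurable ?_) (ae_of_all _ fun u => ?_)
  · exact (hf.sub (measurable_const.indicator (measurableSet_abs_sub_lt z))).div (by fun_prop)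
  · simp only [Pi.add_apply, regularizedKernel]
    by_cases h : |u - z| < 1
    · have m1 : u ∈ {u : ℝ | |u - z| < 1} := h
      have m2 : u - z ∈ Set.Ioo (-1 : ℝ) 1 := abs_lt.1 h
      rw [Set.indicator_of_mem m1, Set.indicator_of_mem m2, norm_div, Real.norm_eq_abs,
        Real.norm_eq_abs (z - u), abs_sub_comm z u]
      have h3 : |f u - f z| / |u - z| ≤ C * (√|u - z|)⁻¹ := by
        rcases (abs_nonneg (u - z)).eq_or_lt with h0 | h0
        · simp [← h0]
        · rw [div_le_iff₀ h0]
          refine (hC u h).trans (le_of_eq ?_)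
          have hs : 0 < √|u - z| := Real.sqrt_pos.2 h0
          have hm : √|u - z| * √|u - z| = |u - z| := Real.mul_self_sqrt h0.le
          nth_rw 3 [← hm]
          field_simp
      linarith [norm_nonneg (f u)]
    · have m1 : u ∉ {u : ℝ | |u - z| < 1} := h
      have m2 : u - z ∉ Set.Ioo (-1 : ℝ) 1 := fun hh => h (abs_lt.2 hh)
      rw [Set.indicator_of_notMem m1, Set.indicator_of_notMem m2, mul_zero, zero_add, sub_zero,
        norm_div, Real.norm_eq_abs (z - u), abs_sub_comm]
      exact div_le_self (norm_nonneg _) (not_lt.1 h)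

theorem integral_eq_zero_of_reflect {g : ℝ → ℝ} {z : ℝ} (h : ∀ u, g (2 * z - u) = -g u) :
    ∫ u, g u = 0 := by
  have h1 := integral_sub_left_eq_self g volume (2 * z)
  simp_rw [h] at h1
  rw [integral_neg] at h1
  linarith

theorem integrableOn_truncation_div {g : ℝ → ℝ} (hg : Measurable g) (hgi : Integrable g) (z : ℝ)
    {ε : ℝ} (hε : 0 < ε) : IntegrableOn (fun u => g u / (z - u)) {u : ℝ | ε < |u - z|} := by
  refine (hgi.norm.div_const ε).restrict.mono' (Measurable.aestronglyMeasurable (by fun_prop)) ?_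
  filter_upwards [ae_restrict_mem (measurableSet_truncation ε z)] with u hu
  have hu : ε < |u - z| := hu
  rw [norm_div, Real.norm_eq_abs (z - u), abs_sub_comm]
  gcongr

/-- Existence of the principal value where the density is Hölder continuous. -/
theorem hasPV_of_holder {f : ℝ → ℝ} (hf : Measurable f) (hfi : Integrable f)
    {z C : ℝ} (hC : ∀ u, |u - z| < 1 → |f u - f z| ≤ C * √|u - z|) :
    HasPV f z (∫ u, regularizedKernel f z u) := by
  have hi := integrable_regularizedKernel hf hfi hC
  have h1 : Tendsto (fun ε : ℝ => ∫ u, {u : ℝ | ε < |u - z|}.indicator (regularizedKernel f z) u)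
      (𝓝[>] 0) (𝓝 (∫ u, regularizedKernel f z u)) := by
    refine tendsto_integral_filter_of_dominated_convergence (fun u => ‖regularizedKernel f z u‖)
      (Eventually.of_forall fun ε => hi.1.indicator (measurableSet_truncation ε z))
      (Eventually.of_forall fun ε => ae_of_all _ fun u => norm_indicator_le_norm_self _ _)
      hi.norm ?_
    filter_upwards [(measure_eq_zero_iff_ae_notMem).1 (measure_singleton (μ := volume) z)] with u hu
    have hpos : 0 < |u - z| := abs_pos.2 (sub_ne_zero.2 hu)
    refine tendsto_const_nhds.congr' ?_
    filter_upwards [Ioo_mem_nhdsGT hpos] with ε hε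
    rw [Set.indicator_of_mem (show u ∈ {u : ℝ | ε < |u - z|} from hε.2)]
  refine h1.congr' ?_
  filter_upwards [self_mem_nhdsWithin] with ε hε
  have hε : 0 < ε := hε
  set k : ℝ → ℝ := {u : ℝ | |u - z| < 1}.indicator (fun _ => f z) with hk
  have hkm : Measurable k := measurable_const.indicator (measurableSet_abs_sub_lt z)
  have hki : Integrable k := by
    refine (integrable_indicator_iff (measurableSet_abs_sub_lt z)).2 (integrableOn_const ?_)
    have : {u : ℝ | |u - z| < 1} = Metric.ball z 1 := by ext; simp [Real.dist_eq]
    rw [this]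
    exact measure_ball_lt_top.ne
  rw [integral_indicator (measurableSet_truncation ε z)]
  -- The subtracted constant lives on a window symmetric about $z$, so it contributes an odd
  -- integrand to every symmetric truncation.
  have h0 : ∫ u in {u : ℝ | ε < |u - z|}, k u / (z - u) = 0 := by
    rw [← integral_indicator (measurableSet_truncation ε z)]
    refine integral_eq_zero_of_reflect (z := z) fun u => ?_
    have e : |2 * z - u - z| = |u - z| := by rw [← abs_neg]; congr 1; ring
    simp only [hk, Set.indicator, Set.mem_ofPred_eq, e]
    rw [show z - (2 * z - u) = -(z - u) by ring]
    split_ifs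
    · exact div_neg _
    all_goals simp
  have h2 : ∫ u in {u : ℝ | ε < |u - z|}, regularizedKernel f z u
      = (∫ u in {u : ℝ | ε < |u - z|}, f u / (z - u))
        - ∫ u in {u : ℝ | ε < |u - z|}, k u / (z - u) := by
    rw [← integral_sub (integrableOn_truncation_div hf hfi z hε)
      (integrableOn_truncation_div hkm hki z hε)]
    simp only [regularizedKernel, sub_div, hk]
  rw [h2, h0, sub_zero]

/-- At an end point of the interval the principal value is a radial limit in the Joukowski
coordinate, provided that the density vanishes there. -/
theorem tendsto_re_cauchyTransform_endpoint {f : ℝ → ℝ} (hf : Measurable f)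
    {c r s : ℝ} (hr : 0 < r) (hs1 : s = 1 ∨ s = -1)
    (hs : ∀ u, u ∉ Set.Icc (c - r) (c + r) → f u = 0)
    (hi : Integrable fun u => f u / (c + r * s - u)) :
    Tendsto (fun ρ : ℝ => (cauchyTransform f (joukowski c r (ρ * s))).re)
      (𝓝[<] 1) (𝓝 (∫ u, f u / (c + r * s - u))) := by
  have hss : s⁻¹ = s := by rcases hs1 with rfl | rfl <;> norm_num
  set Z : ℝ → ℝ := fun ρ => c + r * ((ρ + ρ⁻¹) / 2) * s with hZ
  have hre : ∀ ρ : ℝ, (cauchyTransform f (joukowski c r (ρ * s))).re = ∫ u, f u / (Z ρ - u) := by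
    intro ρ
    have : joukowski c r (ρ * s) = ((Z ρ : ℝ) : ℂ) := by
      rw [joukowski, mul_inv, ← Complex.ofReal_inv, ← Complex.ofReal_inv, hss, hZ]
      push_cast
      ring
    rw [this, cauchyTransform]
    have e : ∀ u : ℝ, (f u : ℂ) / (((Z ρ : ℝ) : ℂ) - u) = ((f u / (Z ρ - u) : ℝ) : ℂ) := by
      intro u; push_cast; rfl
    simp_rw [e]
    rw [integral_complex_ofReal, Complex.ofReal_re]
  simp_rw [hre]
  refine tendsto_integral_filter_of_dominated_convergence
    (fun u => ‖f u / (c + r * s - u)‖)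
    (Eventually.of_forall fun ρ => Measurable.aestronglyMeasurable (by fun_prop)) ?_ hi.norm ?_
  · filter_upwards [eventually_Ioo_zero_one] with ρ hρ
    filter_upwards [(measure_eq_zero_iff_ae_notMem).1
      (measure_singleton (μ := volume) (c + r * s))] with u hu
    by_cases hmem : u ∈ Set.Icc (c - r) (c + r)
    · have hρ0 := hρ.1
      -- The point `Z ρ` lies beyond the end point, hence farther from every $u$ of the interval;
      -- the integrand at the end point is therefore a majorant.
      have h1 : 1 ≤ (ρ + ρ⁻¹) / 2 := by
        have : (ρ + ρ⁻¹) / 2 - 1 = (1 - ρ) ^ 2 / (2 * ρ) := by field_simp; ring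
        have h2 : 0 ≤ (1 - ρ) ^ 2 / (2 * ρ) := by positivity
        linarith
      have hpos : 0 < |c + r * s - u| := abs_pos.2 fun h => hu (by simp; linarith)
      rw [norm_div, norm_div]
      refine div_le_div_of_nonneg_left (norm_nonneg _) hpos ?_
      rw [Real.norm_eq_abs, Real.norm_eq_abs, hZ]
      rcases hs1 with rfl | rfl
      · rw [abs_of_nonneg (by linarith [hmem.2]), abs_of_nonneg (by nlinarith [hmem.2])]
        nlinarith
      · rw [abs_of_nonpos (by linarith [hmem.1]), abs_of_nonpos (by nlinarith [hmem.1])]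
        nlinarith
    · simp [hs u hmem]
  · filter_upwards [(measure_eq_zero_iff_ae_notMem).1
      (measure_singleton (μ := volume) (c + r * s))] with u hu
    have hne : c + r * s - u ≠ 0 := fun h => hu (by simp; linarith)
    have hc : ContinuousAt (fun ρ => f u / (Z ρ - u)) 1 := by
      refine ContinuousAt.div continuousAt_const ?_ (by simpa [hZ] using hne)
      exact (continuousAt_const.add ((continuousAt_const.mul ((continuousAt_id.add
        (continuousAt_inv₀ one_ne_zero)).div_const 2)).mul continuousAt_const)).sub
        continuousAt_const
    have h := hc.tendsto
    have e : Z 1 = c + r * s := by simp [hZ]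
    rw [e] at h
    exact h.mono_left nhdsWithin_le_nhds

/-! ### The arctangent density and its resolvent -/

/-- The arctangent density with end points `a < b < 1`, in the variable `u`. -/
def arcDensity (a b u : ℝ) : ℝ :=
  2 / Real.pi * Real.arctan √((u - a) * (b - u) / ((1 - a) * (1 - b)))

theorem measurable_arcDensity (a b : ℝ) : Measurable (arcDensity a b) := by
  unfold arcDensity
  exact (Real.continuous_arctan.measurable.comp (by fun_prop)).const_mul _

theorem arcDensity_nonneg (a b u : ℝ) : 0 ≤ arcDensity a b u := by
  have := Real.pi_pos
  have h := Real.arctan_nonneg.2 (Real.sqrt_nonneg ((u - a) * (b - u) / ((1 - a) * (1 - b))))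
  unfold arcDensity
  positivity

theorem arcDensity_le_one (a b u : ℝ) : arcDensity a b u ≤ 1 := by
  have := Real.pi_pos
  have h := (Real.arctan_lt_pi_div_two √((u - a) * (b - u) / ((1 - a) * (1 - b)))).le
  calc arcDensity a b u ≤ 2 / Real.pi * (Real.pi / 2) := by
        unfold arcDensity
        gcongr
    _ = 1 := by field_simp

theorem abs_arcDensity_le (a b u : ℝ) : |arcDensity a b u| ≤ 1 := by
  rw [abs_of_nonneg (arcDensity_nonneg a b u)]
  exact arcDensity_le_one a b u

/-- `Real.sqrt` is $0$ at negative arguments, so `arcDensity` needs no explicit cut-off. -/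
theorem arcDensity_eq_zero {a b u : ℝ} (hab : a < b) (hb : b < 1) (hu : u ∉ Set.Ioo a b) :
    arcDensity a b u = 0 := by
  have h : (u - a) * (b - u) ≤ 0 := by
    rcases le_or_gt u a with h | h
    · exact mul_nonpos_of_nonpos_of_nonneg (by linarith) (by linarith)
    · have : b ≤ u := not_lt.1 fun h' => hu ⟨h, h'⟩
      exact mul_nonpos_of_nonneg_of_nonpos (by linarith) (by linarith)
  have hD : 0 < (1 - a) * (1 - b) := mul_pos (by linarith) (by linarith)
  rw [arcDensity, Real.sqrt_eq_zero_of_nonpos (div_nonpos_of_nonpos_of_nonneg h hD.le)]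
  simp

theorem arcDensity_pos {a b u : ℝ} (hb : b < 1) (hu : u ∈ Set.Ioo a b) :
    0 < arcDensity a b u := by
  have h1 : 0 < u - a := sub_pos.2 hu.1
  have h2 : 0 < b - u := sub_pos.2 hu.2
  have h3 : 0 < 1 - b := sub_pos.2 hb
  have h4 : 0 < 1 - a := by linarith
  have := Real.pi_pos
  have h := Real.arctan_pos.2
    (show 0 < √((u - a) * (b - u) / ((1 - a) * (1 - b))) from Real.sqrt_pos.2 (by positivity))
  unfold arcDensity
  positivity

theorem integrable_of_bounded_of_support {f : ℝ → ℝ} (hf : Measurable f) {M a b : ℝ}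
    (hM : ∀ u, |f u| ≤ M) (hs : ∀ u, u ∉ Set.Icc a b → f u = 0) : Integrable f := by
  rw [← integrableOn_iff_integrable_of_support_subset (s := Set.Icc a b)
    (fun u hu => by_contra fun h => hu (hs u h))]
  exact Measure.integrableOn_of_bounded (M := M) (by simp) hf.aestronglyMeasurable
    (ae_of_all _ hM)

theorem abs_arctan_sub_le (x y : ℝ) : |Real.arctan x - Real.arctan y| ≤ |x - y| := by
  have h := (convex_univ (𝕜 := ℝ) (E := ℝ)).norm_image_sub_le_of_norm_hasDerivWithin_le
    (f := Real.arctan) (f' := fun x => 1 / (1 + x ^ 2)) (C := 1) (x := y) (y := x)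
    (fun x _ => (Real.hasDerivAt_arctan x).hasDerivWithinAt) (fun x _ => ?_) trivial trivial
  · simpa using h
  · rw [Real.norm_of_nonneg (by positivity), div_le_one (by positivity)]
    nlinarith [sq_nonneg x]

theorem abs_sqrt_sub_sqrt_le (x y : ℝ) : |√x - √y| ≤ √|x - y| := by
  wlog h : y ≤ x generalizing x y
  · rw [abs_sub_comm, abs_sub_comm x y]
    exact this y x (le_of_not_ge h)
  rw [abs_of_nonneg (sub_nonneg.2 (Real.sqrt_le_sqrt h)), abs_of_nonneg (sub_nonneg.2 h)]
  rcases le_or_gt y 0 with hy | hy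
  · rw [Real.sqrt_eq_zero_of_nonpos hy, sub_zero]
    exact Real.sqrt_le_sqrt (by linarith)
  · rw [sub_le_iff_le_add]
    refine Real.sqrt_le_iff.2 ⟨by positivity, ?_⟩
    have h1 := Real.sq_sqrt (sub_nonneg.2 h)
    have h2 := Real.sq_sqrt hy.le
    nlinarith [mul_nonneg (Real.sqrt_nonneg (x - y)) (Real.sqrt_nonneg y)]

/-- The arctangent is $1$-Lipschitz, the square root is Hölder of exponent $1/2$, and the difference
of the quadratic radicands has the factor $u-z$. The estimate also covers the end points. -/
theorem exists_holder_arcDensity (a b z : ℝ) :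
    ∃ C, ∀ u, |u - z| < 1 → |arcDensity a b u - arcDensity a b z| ≤ C * √|u - z| := by
  set D := (1 - a) * (1 - b) with hD
  refine ⟨2 / Real.pi * √((|a + b - 2 * z| + 1) / |D|), fun u hu => ?_⟩
  have hpi := Real.pi_pos
  rw [arcDensity, arcDensity, ← mul_sub, abs_mul, abs_of_pos (by positivity : 0 < 2 / Real.pi),
    mul_assoc]
  refine mul_le_mul_of_nonneg_left ?_ (by positivity)
  refine (abs_arctan_sub_le _ _).trans ((abs_sqrt_sub_sqrt_le _ _).trans ?_)
  rw [← Real.sqrt_mul (by positivity)]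
  refine Real.sqrt_le_sqrt ?_
  rw [← hD, ← sub_div, abs_div, div_mul_eq_mul_div]
  refine div_le_div_of_nonneg_right ?_ (abs_nonneg _)
  rw [show (u - a) * (b - u) - (z - a) * (b - z) = (a + b - 2 * z - (u - z)) * (u - z) by ring,
    abs_mul]
  refine mul_le_mul_of_nonneg_right ((abs_sub _ _).trans ?_) (abs_nonneg _)
  linarith

/-- For $w=qe^{i\varphi}$ the quotient $(1+w)/(1-w)$ has positive real part, and its imaginary and
real parts are in the ratio $2q\sin\varphi:(1-q^2)$. Since $1\pm w$ lie in the right half-plane, no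
branch jump occurs in the difference of logarithms. -/
theorem arctan_eq_im_log {q : ℝ} (hq0 : 0 < q) (hq1 : q < 1) (φ : ℝ) :
    Real.arctan (2 * q * Real.sin φ / (1 - q ^ 2))
      = (Complex.log (1 + q * Complex.exp (φ * Complex.I))
        - Complex.log (1 - q * Complex.exp (φ * Complex.I))).im := by
  set w : ℂ := q * Complex.exp (φ * Complex.I) with hw
  have hre : w.re = q * Real.cos φ := by
    rw [hw, Complex.re_ofReal_mul, Complex.exp_ofReal_mul_I_re]
  have him : w.im = q * Real.sin φ := by
    rw [hw, Complex.im_ofReal_mul, Complex.exp_ofReal_mul_I_im]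
  have hc1 := Real.cos_le_one φ
  have hc2 := Real.neg_one_le_cos φ
  have h1 : 0 < (1 + w).re := by simp [hre]; nlinarith
  have h2 : 0 < (1 - w).re := by simp [hre]; nlinarith
  have n1 : 1 + w ≠ 0 := fun h => by rw [h] at h1; simp at h1
  have n2 : 1 - w ≠ 0 := fun h => by rw [h] at h2; simp at h2
  have a1 := abs_lt.1 (Complex.abs_arg_lt_pi_div_two_iff.2 (Or.inl h1))
  have a2 := abs_lt.1 (Complex.abs_arg_lt_pi_div_two_iff.2 (Or.inl h2))
  have him2 : (Complex.log (1 + w) - Complex.log (1 - w)).im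
      = Complex.arg (1 + w) - Complex.arg (1 - w) := by
    rw [Complex.sub_im, Complex.log_im, Complex.log_im]
  have hlog : Complex.log (1 + w) - Complex.log (1 - w) = Complex.log ((1 + w) / (1 - w)) := by
    rw [← Complex.log_exp (x := Complex.log (1 + w) - Complex.log (1 - w)) (by rw [him2]; linarith)
      (by rw [him2]; linarith), Complex.exp_sub, Complex.exp_log n1, Complex.exp_log n2]
  rw [hlog, Complex.log_im]
  have hn : 0 < Complex.normSq (1 - w) := Complex.normSq_pos.2 n2
  have hq2 : 0 < 1 - q ^ 2 := by nlinarith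
  have hsq := Real.sin_sq_add_cos_sq φ
  have hqre : ((1 + w) / (1 - w)).re = (1 - q ^ 2) / Complex.normSq (1 - w) := by
    rw [Complex.div_re, ← add_div]
    congr 1
    simp [hre, him]
    linear_combination (-q ^ 2) * hsq
  have hqim : ((1 + w) / (1 - w)).im = 2 * q * Real.sin φ / Complex.normSq (1 - w) := by
    rw [Complex.div_im, ← sub_div]
    congr 1
    simp [hre, him]
    ring
  have hpos : 0 < ((1 + w) / (1 - w)).re := by rw [hqre]; positivity
  have a3 := abs_lt.1 (Complex.abs_arg_lt_pi_div_two_iff.2 (Or.inl hpos))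
  have : 2 * q * Real.sin φ / (1 - q ^ 2)
      = ((1 + w) / (1 - w)).im / ((1 + w) / (1 - w)).re := by
    rw [hqre, hqim]
    field_simp
  rw [this, ← Complex.tan_arg, Real.arctan_tan a3.1 a3.2]

/-- The Taylor coefficients of `log (1 + q w) - log (1 - q w)`. -/
def logCoeff (q : ℝ) (n : ℕ) : ℝ := (1 - (-1) ^ n) * q ^ n / n

theorem abs_logCoeff_le {q : ℝ} (hq0 : 0 < q) (n : ℕ) : |logCoeff q n| ≤ 2 * q ^ n := by
  have h : |(1 : ℝ) - (-1) ^ n| ≤ 2 := by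
    rcases neg_one_pow_eq_or ℝ n with h | h <;> rw [h] <;> norm_num
  rcases Nat.eq_zero_or_pos n with rfl | hn
  · simp [logCoeff]
  · have hn1 : (1 : ℝ) ≤ n := by exact_mod_cast hn
    rw [logCoeff, abs_div, abs_mul, abs_of_pos (pow_pos hq0 n), Nat.abs_cast]
    exact (div_le_self (by positivity) hn1).trans
      (mul_le_mul_of_nonneg_right h (by positivity))

theorem hasSum_logCoeff {q : ℝ} {w : ℂ} (hw : ‖(q : ℂ) * w‖ < 1) :
    HasSum (fun n : ℕ => (logCoeff q n : ℂ) * w ^ n)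
      (Complex.log (1 + q * w) - Complex.log (1 - q * w)) := by
  refine hasSum_of_forall_eq ((Complex.hasSum_taylorSeries_log hw).add
    (Complex.hasSum_taylorSeries_neg_log hw)) (fun n => ?_) (sub_eq_add_neg _ _)
  rw [logCoeff]
  push_cast
  rw [mul_pow]
  ring

/-- The imaginary part of the Taylor series of $\ln\frac{1+w}{1-w}$ is the sine series of the
arctangent; orthogonality then selects one coefficient, and $2/\pi$ cancels $\pi/2$. -/
theorem sineMoment_arctan {q : ℝ} (hq0 : 0 < q) (hq1 : q < 1) (n : ℕ) :
    sineMoment (fun φ => 2 / Real.pi * Real.arctan (2 * q * Real.sin φ / (1 - q ^ 2))) n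
      = logCoeff q n := by
  have hser : ∀ φ : ℝ, HasSum (fun m : ℕ => logCoeff q m * Real.sin (m * φ))
      (Real.arctan (2 * q * Real.sin φ / (1 - q ^ 2))) := by
    intro φ
    rw [arctan_eq_im_log hq0 hq1]
    have hn : ‖(q : ℂ) * Complex.exp (φ * Complex.I)‖ < 1 := by
      rw [norm_mul, Complex.norm_exp_ofReal_mul_I, Complex.norm_real, mul_one,
        Real.norm_of_nonneg hq0.le]
      exact hq1
    have h := Complex.hasSum_im (hasSum_logCoeff hn)
    refine h.congr_fun fun m => ?_
    rw [← Complex.exp_nat_mul, Complex.im_ofReal_mul,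
      show (m : ℂ) * (φ * Complex.I) = ((m * φ : ℝ) : ℂ) * Complex.I by push_cast; ring,
      Complex.exp_ofReal_mul_I_im]
  have h := intervalIntegral.hasSum_integral_of_dominated_convergence (μ := volume)
    (a := 0) (b := Real.pi)
    (F := fun (m : ℕ) (φ : ℝ) => (2 / Real.pi * logCoeff q m) * (Real.sin (m * φ) * Real.sin (n * φ)))
    (f := fun φ => 2 / Real.pi * Real.arctan (2 * q * Real.sin φ / (1 - q ^ 2)) * Real.sin (n * φ))
    (fun m _ => 2 / Real.pi * (2 * q ^ m))
    (fun m => Continuous.aestronglyMeasurable (by fun_prop)) (fun m => ae_of_all _ fun φ _ => ?_)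
    (ae_of_all _ fun φ _ => ((summable_geometric_of_lt_one hq0.le hq1).mul_left 2).mul_left _)
    intervalIntegrable_const (ae_of_all _ fun φ _ => ?_)
  · refine h.unique ?_
    simp_rw [intervalIntegral.integral_const_mul]
    have h2 := hasSum_single (f := fun m : ℕ => 2 / Real.pi * logCoeff q m *
      ∫ φ in (0 : ℝ)..Real.pi, Real.sin (m * φ) * Real.sin (n * φ)) n (fun m hm => ?_)
    · convert! h2 using 1
      rcases eq_or_ne n 0 with rfl | hn
      · simp [logCoeff]
      · rw [integral_sin_mul_sin n n hn, if_pos rfl]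
        have := Real.pi_ne_zero
        field_simp
    · rcases eq_or_ne m 0 with rfl | hm0
      · simp
      · rw [integral_sin_mul_sin m n hm0, if_neg hm, mul_zero]
  · have hp := Real.pi_pos
    rw [norm_mul, norm_mul, Real.norm_of_nonneg (by positivity : 0 ≤ 2 / Real.pi), norm_mul]
    calc 2 / Real.pi * ‖logCoeff q m‖ * (‖Real.sin (m * φ)‖ * ‖Real.sin (n * φ)‖)
        ≤ 2 / Real.pi * (2 * q ^ m) * (1 * 1) := by
          gcongr
          · exact abs_logCoeff_le hq0 m
          · exact Real.abs_sin_le_one _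
          · exact Real.abs_sin_le_one _
      _ = 2 / Real.pi * (2 * q ^ m) := by ring
  · refine (((hser φ).mul_left (2 / Real.pi)).mul_right (Real.sin (n * φ))).congr_fun fun m => ?_
    ring

section

variable {c r q : ℝ}

/-- The relation `hq` says that $q$ is the Joukowski coordinate of the point $1$. Then $(1-c)^2-r^2$
is the square of $r(1-q^2)/(2q)$, and the root disappears. -/
theorem arcDensity_cos (hr : 0 < r) (hq0 : 0 < q) (hq1 : q < 1)
    (hq : r * (q + q⁻¹) = 2 * (1 - c)) {φ : ℝ} (hφ : 0 ≤ Real.sin φ) :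
    arcDensity (c - r) (c + r) (c + r * Real.cos φ)
      = 2 / Real.pi * Real.arctan (2 * q * Real.sin φ / (1 - q ^ 2)) := by
  have hq2 : 0 < 1 - q ^ 2 := by nlinarith
  have e : (c + r * Real.cos φ - (c - r)) * (c + r - (c + r * Real.cos φ))
      / ((1 - (c - r)) * (1 - (c + r))) = (2 * q * Real.sin φ / (1 - q ^ 2)) ^ 2 := by
    have e1 : (c + r * Real.cos φ - (c - r)) * (c + r - (c + r * Real.cos φ))
        = (r * Real.sin φ) ^ 2 := by
      linear_combination (-r ^ 2) * Real.sin_sq_add_cos_sq φ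
    have e2 : (1 - (c - r)) * (1 - (c + r)) = (r * (1 - q ^ 2) / (2 * q)) ^ 2 := by
      have : 1 - c = r * (q + q⁻¹) / 2 := by linarith
      rw [show (1 - (c - r)) * (1 - (c + r)) = (1 - c) ^ 2 - r ^ 2 by ring, this]
      field_simp
      ring
    rw [e1, e2]
    field_simp
  rw [arcDensity, e, Real.sqrt_sq (by positivity)]

theorem sineMoment_arcDensity (hr : 0 < r) (hq0 : 0 < q) (hq1 : q < 1)
    (hq : r * (q + q⁻¹) = 2 * (1 - c)) (n : ℕ) :
    sineMoment (fun φ => arcDensity (c - r) (c + r) (c + r * Real.cos φ)) n = logCoeff q n := by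
  rw [← sineMoment_arctan hq0 hq1 n, sineMoment, sineMoment]
  refine intervalIntegral.integral_congr fun φ hφ => ?_
  rw [Set.uIcc_of_le Real.pi_pos.le] at hφ
  rw [arcDensity_cos hr hq0 hq1 hq (Real.sin_nonneg_of_mem_Icc hφ)]

theorem add_lt_one_of_param (hr : 0 < r) (hq0 : 0 < q) (hq1 : q < 1)
    (hq : r * (q + q⁻¹) = 2 * (1 - c)) : c + r < 1 := by
  have : q + q⁻¹ - 2 = (1 - q) ^ 2 / q := by field_simp; ring
  have h1 : 0 < 1 - q := by linarith
  have h2 : 0 < (1 - q) ^ 2 / q := by positivity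
  nlinarith

theorem arcDensity_eq_zero_of_notMem (hr : 0 < r) (hq0 : 0 < q) (hq1 : q < 1)
    (hq : r * (q + q⁻¹) = 2 * (1 - c)) (u : ℝ) (hu : u ∉ Set.Icc (c - r) (c + r)) :
    arcDensity (c - r) (c + r) u = 0 :=
  arcDensity_eq_zero (by linarith) (add_lt_one_of_param hr hq0 hq1 hq)
    fun h => hu (Set.Ioo_subset_Icc_self h)

/-- The resolvent of the arctangent density. -/
theorem cauchyTransform_arcDensity (hr : 0 < r) (hq0 : 0 < q) (hq1 : q < 1)
    (hq : r * (q + q⁻¹) = 2 * (1 - c)) {w : ℂ} (hw0 : w ≠ 0) (hw : ‖w‖ < 1) :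
    cauchyTransform (arcDensity (c - r) (c + r)) (joukowski c r w)
      = 2 * (Complex.log (1 + q * w) - Complex.log (1 - q * w)) := by
  have h1 := hasSum_cauchyTransform_joukowski hr (measurable_arcDensity (c - r) (c + r))
    (abs_arcDensity_le _ _) (arcDensity_eq_zero_of_notMem hr hq0 hq1 hq) hw0 hw
  refine h1.unique ?_
  have hqw : ‖(q : ℂ) * w‖ < 1 := by
    rw [norm_mul, Complex.norm_real, Real.norm_of_nonneg hq0.le]
    nlinarith [norm_nonneg w]
  refine hasSum_of_forall_eq ((hasSum_logCoeff hqw).mul_left 2) (fun n => ?_) rfl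
  rw [sineMoment_arcDensity hr hq0 hq1 hq]
  ring

/-- Because $q<1$, the arguments of the logarithms stay in the right half-plane up to $\rho=1$, so
the limit is a value of a continuous function, $\ln\frac{|1+qe^{-i\theta}|^2}{|1-qe^{-i\theta}|^2}$.
-/
theorem tendsto_re_log (hq0 : 0 < q) (hq1 : q < 1) (θ : ℝ) :
    Tendsto (fun ρ : ℝ => (2 * (Complex.log (1 + q * (ρ * Complex.exp (-(θ * Complex.I))))
        - Complex.log (1 - q * (ρ * Complex.exp (-(θ * Complex.I)))))).re) (𝓝[<] 1)
      (𝓝 (Real.log ((1 + q ^ 2 + 2 * q * Real.cos θ) / (1 + q ^ 2 - 2 * q * Real.cos θ)))) := by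
  set e := Complex.exp (-(θ * Complex.I)) with he
  have hre : e.re = Real.cos θ := by
    rw [he, ← neg_mul, ← Complex.ofReal_neg, Complex.exp_ofReal_mul_I_re, Real.cos_neg]
  have him : e.im = -Real.sin θ := by
    rw [he, ← neg_mul, ← Complex.ofReal_neg, Complex.exp_ofReal_mul_I_im, Real.sin_neg]
  have hc1 := Real.cos_le_one θ
  have hc2 := Real.neg_one_le_cos θ
  have h1 : 0 < (1 + q * e).re := by simp [hre]; nlinarith
  have h2 : 0 < (1 - q * e).re := by simp [hre]; nlinarith
  have n1 : 1 + q * e ≠ 0 := fun h => by rw [h] at h1; simp at h1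
  have n2 : 1 - q * e ≠ 0 := fun h => by rw [h] at h2; simp at h2
  have hc : ContinuousAt (fun ρ : ℝ => (2 * (Complex.log (1 + q * (ρ * e))
      - Complex.log (1 - q * (ρ * e)))).re) 1 := by
    refine Complex.continuous_re.continuousAt.comp (continuousAt_const.mul (ContinuousAt.sub ?_ ?_))
    · refine ContinuousAt.clog (by fun_prop) ?_
      rw [Complex.ofReal_one, one_mul]
      exact Complex.mem_slitPlane_iff.2 (Or.inl h1)
    · refine ContinuousAt.clog (by fun_prop) ?_
      rw [Complex.ofReal_one, one_mul]
      exact Complex.mem_slitPlane_iff.2 (Or.inl h2)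
  have h := hc.tendsto.mono_left (nhdsWithin_le_nhds (s := Set.Iio 1))
  convert! h using 2
  have hsq := Real.sin_sq_add_cos_sq θ
  have s1 : Complex.normSq (1 + q * e) = 1 + q ^ 2 + 2 * q * Real.cos θ := by
    rw [Complex.normSq_apply]
    simp [hre, him]
    linear_combination q ^ 2 * hsq
  have s2 : Complex.normSq (1 - q * e) = 1 + q ^ 2 - 2 * q * Real.cos θ := by
    rw [Complex.normSq_apply]
    simp [hre, him]
    linear_combination q ^ 2 * hsq
  rw [← s1, ← s2, Complex.normSq_eq_norm_sq, Complex.normSq_eq_norm_sq,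
    Real.log_div (by simpa using n1) (by simpa using n2), Real.log_pow, Real.log_pow]
  simp [Complex.log_re]
  ring

/-- The arctangent density solves the airfoil equation on its closed support. -/
theorem hasPV_arcDensity (hr : 0 < r) (hq0 : 0 < q) (hq1 : q < 1)
    (hq : r * (q + q⁻¹) = 2 * (1 - c)) {z : ℝ} (hz : z ∈ Set.Icc (c - r) (c + r)) :
    HasPV (arcDensity (c - r) (c + r)) z (Real.log ((z - (2 * c - 1)) / (1 - z))) := by
  set f := arcDensity (c - r) (c + r) with hf
  have hfm : Measurable f := measurable_arcDensity _ _
  have hfs := arcDensity_eq_zero_of_notMem hr hq0 hq1 hq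
  have hfi : Integrable f := integrable_of_bounded_of_support hfm (abs_arcDensity_le _ _) hfs
  obtain ⟨C, hC⟩ := exists_holder_arcDensity (c - r) (c + r) z
  have hpv := hasPV_of_holder hfm hfi hC
  set θ := Real.arccos ((z - c) / r) with hθ
  have hcos : Real.cos θ = (z - c) / r :=
    Real.cos_arccos (by rw [le_div_iff₀ hr]; linarith [hz.1])
      (by rw [div_le_iff₀ hr]; linarith [hz.2])
  have hzθ : z = c + r * Real.cos θ := by rw [hcos]; field_simp; ring
  -- Here $2c-1$ stands for $L$, the reflection of $1$ in the centre $c$; the distances from $z$ to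
  -- $L$ and to $1$ are the same multiple of $|1\pm qe^{-i\theta}|^2$.
  have hval : Real.log ((1 + q ^ 2 + 2 * q * Real.cos θ) / (1 + q ^ 2 - 2 * q * Real.cos θ))
      = Real.log ((z - (2 * c - 1)) / (1 - z)) := by
    have e1 : z - (2 * c - 1) = r / (2 * q) * (1 + q ^ 2 + 2 * q * Real.cos θ) := by
      rw [hzθ, show c + r * Real.cos θ - (2 * c - 1) = 2 * (1 - c) / 2 + r * Real.cos θ by ring,
        ← hq]
      field_simp
      ring
    have e2 : 1 - z = r / (2 * q) * (1 + q ^ 2 - 2 * q * Real.cos θ) := by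
      rw [hzθ, show 1 - (c + r * Real.cos θ) = 2 * (1 - c) / 2 - r * Real.cos θ by ring,
        ← hq]
      field_simp
      ring
    rw [e1, e2, mul_div_mul_left _ _ (by positivity)]
  have hlim : Tendsto (fun ρ : ℝ =>
      (cauchyTransform f (joukowski c r (ρ * Complex.exp (-(θ * Complex.I))))).re)
      (𝓝[<] 1) (𝓝 (Real.log ((z - (2 * c - 1)) / (1 - z)))) := by
    rw [← hval]
    refine (tendsto_re_log hq0 hq1 θ).congr' ?_
    filter_upwards [eventually_Ioo_zero_one] with ρ hρ
    rw [cauchyTransform_arcDensity hr hq0 hq1 hq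
      (mul_ne_zero (by exact_mod_cast hρ.1.ne') (Complex.exp_ne_zero _))
      (by rw [norm_polar θ ρ hρ.1.le]; exact hρ.2)]
  -- The Hölder estimate has given existence of the principal value; uniqueness of radial limits
  -- identifies it.
  by_cases hin : θ ∈ Set.Ioo 0 Real.pi
  · generalize ∫ u, regularizedKernel f z u = v at hpv
    have h := tendsto_re_cauchyTransform_joukowski hfm hfi (abs_arcDensity_le _ _) hr hin
      (hzθ ▸ hpv)
    rwa [← tendsto_nhds_unique hlim h] at hpv
  · have hs1 : Real.cos θ = 1 ∨ Real.cos θ = -1 := by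
      rcases (Real.arccos_nonneg ((z - c) / r)).eq_or_lt with h | h
      · left; rw [hθ, ← h, Real.cos_zero]
      · right
        have : θ = Real.pi := le_antisymm (Real.arccos_le_pi _)
          (not_lt.1 fun h' => hin ⟨h, h'⟩)
        rw [this, Real.cos_pi]
    have hsin : Real.sin θ = 0 := by
      have := Real.sin_sq_add_cos_sq θ
      rcases hs1 with h | h <;> rw [h] at this <;> nlinarith
    have hexp : Complex.exp (-(θ * Complex.I)) = ((Real.cos θ : ℝ) : ℂ) := by
      rw [← neg_mul, ← Complex.ofReal_neg, Complex.exp_mul_I, ← Complex.ofReal_cos,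
        ← Complex.ofReal_sin, Real.cos_neg, Real.sin_neg, hsin]
      simp
    have hfz : f z = 0 := by
      refine arcDensity_eq_zero (by linarith) (add_lt_one_of_param hr hq0 hq1 hq) fun h => ?_
      rcases hs1 with h1 | h1 <;> rw [h1] at hzθ <;> linarith [h.1, h.2]
    -- At an end point the density vanishes, so nothing is subtracted and the integral converges
    -- absolutely.
    have hreg : regularizedKernel f z = fun u => f u / (z - u) := by
      funext u
      simp [regularizedKernel, hfz, Set.indicator]
    have hi := integrable_regularizedKernel hfm hfi hC
    rw [hreg] at hpv hi
    have h := tendsto_re_cauchyTransform_endpoint hfm hr hs1 hfs (hzθ ▸ hi)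
    simp_rw [hexp] at hlim
    rw [← hzθ] at h
    rwa [← tendsto_nhds_unique hlim h] at hpv

end

/-! ### The weighted mass and the product of the end points -/

/-- The witness is the smaller root of $rq^2-2sq+r=0$; the product of the roots is $1$. -/
theorem exists_joukowski_param {r s : ℝ} (hr : 0 < r) (hs : r < s) :
    ∃ q : ℝ, 0 < q ∧ q < 1 ∧ r * (q + q⁻¹) = 2 * s := by
  have h0 : 0 < s ^ 2 - r ^ 2 := by nlinarith
  set t := √(s ^ 2 - r ^ 2) with ht
  have ht2 : t ^ 2 = s ^ 2 - r ^ 2 := Real.sq_sqrt h0.le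
  have htp : 0 < t := Real.sqrt_pos.2 h0
  have hst : 0 < s + t := by linarith
  refine ⟨r / (s + t), by positivity, ?_, ?_⟩
  · rw [div_lt_one hst]
    linarith
  · field_simp
    linear_combination ht2

/-- The point $0$ lies to the left of the interval and has Joukowski coordinate $-\omega$; the
resolvent there is minus the integral. -/
theorem integral_arcDensity_div {c r q ω : ℝ} (hr : 0 < r) (hq0 : 0 < q) (hq1 : q < 1)
    (hq : r * (q + q⁻¹) = 2 * (1 - c)) (hω0 : 0 < ω) (hω1 : ω < 1) (hω : r * (ω + ω⁻¹) = 2 * c) :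
    ∫ u, arcDensity (c - r) (c + r) u / u = 2 * (Real.log (1 + q * ω) - Real.log (1 - q * ω)) := by
  have h := cauchyTransform_arcDensity hr hq0 hq1 hq (w := ((-ω : ℝ) : ℂ))
    (by exact_mod_cast (neg_ne_zero.2 hω0.ne'))
    (by rw [Complex.norm_real, norm_neg, Real.norm_of_nonneg hω0.le]; exact hω1)
  have hz : joukowski c r ((-ω : ℝ) : ℂ) = 0 := by
    rw [joukowski, ← Complex.ofReal_inv, inv_neg]
    have : ((c + r * (-ω + -ω⁻¹) / 2 : ℝ) : ℂ) = 0 := by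
      rw [Complex.ofReal_eq_zero]
      linarith
    rw [← this]
    push_cast
    ring
  have hqω : q * ω < 1 := by nlinarith
  have hl : ∫ u, ((arcDensity (c - r) (c + r) u : ℝ) : ℂ) / (0 - (u : ℂ))
      = ((-∫ u, arcDensity (c - r) (c + r) u / u : ℝ) : ℂ) := by
    rw [← integral_neg, ← integral_complex_ofReal]
    refine integral_congr_ae (ae_of_all _ fun u => ?_)
    push_cast
    rw [zero_sub, div_neg]
  have e1 : (1 + q * ((-ω : ℝ) : ℂ)) = ((1 - q * ω : ℝ) : ℂ) := by push_cast; ring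
  have e2 : (1 - q * ((-ω : ℝ) : ℂ)) = ((1 + q * ω : ℝ) : ℂ) := by push_cast; ring
  rw [hz, cauchyTransform, hl, e1, e2, ← Complex.ofReal_log (by linarith),
    ← Complex.ofReal_log (by positivity)] at h
  have h' : -∫ u, arcDensity (c - r) (c + r) u / u
      = 2 * (Real.log (1 - q * ω) - Real.log (1 + q * ω)) := by exact_mod_cast h
  linarith

/-- The weighted mass of the arctangent density, in parametric form. -/
theorem exists_param_integral_arcDensity_div {L a b : ℝ} (hL : 0 < L) (hLa : L < a) (hab : a < b)
    (hs : a + b = 1 + L) :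
    ∃ E : ℝ, 0 < E ∧ E < 1 ∧ Real.exp (-∫ u, arcDensity a b u / u) = L / E ∧
      a * b = L * (1 + E) ^ 2 / (4 * E) := by
  obtain ⟨c, r, rfl, rfl⟩ : ∃ c r, a = c - r ∧ b = c + r :=
    ⟨(a + b) / 2, (b - a) / 2, by ring, by ring⟩
  have hr : 0 < r := by linarith
  obtain rfl : L = 2 * c - 1 := by linarith
  obtain ⟨q, hq0, hq1, hq⟩ := exists_joukowski_param (s := 1 - c) hr (by linarith)
  obtain ⟨ω, hω0, hω1, hω⟩ := exists_joukowski_param (s := c) hr (by linarith)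
  -- The function $t+t^{-1}$ decreases on $(0,1)$, and $c>1-c$ because $L>0$.
  have hlt : ω < q := by
    have h1 : 0 < r * ((ω + ω⁻¹) - (q + q⁻¹)) := by rw [mul_sub, hq, hω]; linarith
    have h2 : 0 < (ω + ω⁻¹) - (q + q⁻¹) := by
      by_contra h
      nlinarith
    have h3 : (ω + ω⁻¹) - (q + q⁻¹) = (q - ω) * ((1 - q * ω) / (q * ω)) := by field_simp; ring
    rw [h3] at h2
    have h4 : 0 < (1 - q * ω) / (q * ω) := div_pos (by nlinarith) (by positivity)
    linarith [(pos_iff_pos_of_mul_pos h2).2 h4]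
  have hqω : 0 < 1 - q * ω := by nlinarith
  have hd : 0 < q - ω := by linarith
  have hr1 : r = 2 * q * (1 - c) / (1 + q ^ 2) := by
    field_simp at hq ⊢
    linear_combination hq
  have hcω : r * (1 + ω ^ 2) = 2 * c * ω := by
    field_simp at hω
    linear_combination hω
  have hc : c * ((q + ω) * (1 + q * ω)) = q * (1 + ω ^ 2) := by
    rw [hr1] at hcω
    field_simp at hcω
    linear_combination (-1 : ℝ) * hcω
  have hc' : c = q * (1 + ω ^ 2) / ((q + ω) * (1 + q * ω)) := by
    rw [eq_div_iff (by positivity), hc]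
  have hr' : r = 2 * q * ω / ((q + ω) * (1 + q * ω)) := by
    have h1 : r = 2 * c * ω / (1 + ω ^ 2) := by
      rw [eq_div_iff (by positivity), hcω]
    rw [h1, hc']
    field_simp
  have hL' : 2 * c - 1 = (q - ω) * (1 - q * ω) / ((q + ω) * (1 + q * ω)) := by
    rw [hc']
    field_simp
    ring
  -- This is $L$ times the exponential of the mass, with $L$, $c$ and $r$ written as rational
  -- functions of $q$ and $\omega$.
  refine ⟨(q - ω) * (1 + q * ω) / ((q + ω) * (1 - q * ω)), by positivity, ?_, ?_, ?_⟩
  · rw [div_lt_one (by positivity)]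
    nlinarith [mul_pos hω0 (show 0 < 1 - q ^ 2 by nlinarith)]
  · rw [integral_arcDensity_div hr hq0 hq1 hq hω0 hω1 hω, hL',
      show -(2 * (Real.log (1 + q * ω) - Real.log (1 - q * ω)))
        = 2 * Real.log (1 - q * ω) - 2 * Real.log (1 + q * ω) by ring, Real.exp_sub,
      two_mul, two_mul, Real.exp_add, Real.exp_add, Real.exp_log hqω,
      Real.exp_log (by positivity)]
    field_simp
  · rw [hL', show (c - r) * (c + r) = c ^ 2 - r ^ 2 by ring, hc', hr']
    field_simp
    ring

/-- As $L=e^{-\alpha}e^{-\beta}$, the mass is $\beta$ exactly when $E=e^{-\alpha}$. The product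
determines $E$, since $(1+E)^2/E$ takes equal values only at $E$ and $1/E$, and both candidates lie
in $(0,1)$. -/
theorem integral_arcDensity_div_eq_iff {α β a b : ℝ} (hα : 0 < α)
    (hLa : leftEnd α β < a) (hab : a < b) (hs : a + b = 1 + leftEnd α β) :
    ∫ u, arcDensity a b u / u = β ↔
      a * b = leftEnd α β * (1 + Real.exp (-α)) ^ 2 / (4 * Real.exp (-α)) := by
  have hL : 0 < leftEnd α β := Real.exp_pos _
  obtain ⟨E, hE0, hE1, hI, hab2⟩ := exists_param_integral_arcDensity_div hL hLa hab hs
  have he0 := Real.exp_pos (-α)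
  have he1 : Real.exp (-α) < 1 := Real.exp_lt_one_iff.2 (by linarith)
  have hLe : leftEnd α β = Real.exp (-α) * Real.exp (-β) := by
    rw [leftEnd, ← Real.exp_add]
    ring_nf
  have hEe : (∫ u, arcDensity a b u / u = β) ↔ E = Real.exp (-α) := by
    have h1 : (∫ u, arcDensity a b u / u = β) ↔ leftEnd α β / E = Real.exp (-β) := by
      rw [← hI, Real.exp_eq_exp, neg_inj]
    rw [h1, hLe, div_eq_iff hE0.ne', mul_comm (Real.exp (-β)) E,
      mul_left_inj' (Real.exp_pos (-β)).ne']
    exact eq_comm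
  rw [hEe, hab2]
  constructor
  · rintro rfl
    rfl
  · intro h
    rw [div_eq_div_iff (by positivity) (by positivity)] at h
    have h2 : (E - Real.exp (-α)) * (1 - E * Real.exp (-α)) = 0 := by
      have h3 : 4 * leftEnd α β * ((E - Real.exp (-α)) * (1 - E * Real.exp (-α))) = 0 := by
        linear_combination (-1 : ℝ) * h
      exact (mul_eq_zero.1 h3).resolve_left (by positivity)
    rcases mul_eq_zero.1 h2 with h3 | h3
    · linarith
    · nlinarith

/-! ### Uniqueness on a given interval, and symmetry of the interval -/

theorem HasPV.congr_ae {f g : ℝ → ℝ} {z v : ℝ} (h : HasPV f z v) (hfg : ∀ᵐ u, f u = g u) :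
    HasPV g z v := by
  refine Tendsto.congr (fun ε => ?_) h
  refine setIntegral_congr_ae (measurableSet_truncation ε z) ?_
  filter_upwards [hfg] with u hu _
  rw [hu]

/-- The airfoil equation has at most one bounded solution on a given interval. -/
theorem ae_eq_of_hasPV {f g h : ℝ → ℝ} {M N c r : ℝ} (hf : Measurable f) (hg : Measurable g)
    (hM : ∀ u, |f u| ≤ M) (hN : ∀ u, |g u| ≤ N) (hr : 0 < r)
    (hfs : ∀ u, u ∉ Set.Icc (c - r) (c + r) → f u = 0)
    (hgs : ∀ u, u ∉ Set.Icc (c - r) (c + r) → g u = 0)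
    (hfpv : ∀ z ∈ Set.Ioo (c - r) (c + r), HasPV f z (h z))
    (hgpv : ∀ z ∈ Set.Ioo (c - r) (c + r), HasPV g z (h z)) : ∀ᵐ u, f u = g u := by
  have h1 := (integral_pv_mul_cos hf hM hr hfs hfpv).2
  have h2 := (integral_pv_mul_cos hg hN hr hgs hgpv).2
  have hd := ae_eq_zero_of_sineMoment_cos (c := c) (f := fun u => f u - g u) (hf.sub hg) (M := M + N)
    (fun u => (abs_sub _ _).trans (add_le_add (hM u) (hN u))) hr
    (fun u hu => by simp [hfs u hu, hgs u hu]) (fun n => ?_)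
  · filter_upwards [hd] with u hu using sub_eq_zero.1 hu
  · have hi : ∀ {k : ℝ → ℝ} {K : ℝ}, Measurable k → (∀ u, |k u| ≤ K) →
        IntervalIntegrable (fun φ => k (c + r * Real.cos φ) * Real.sin (n * φ)) volume 0
          Real.pi := by
      intro k K hk hK
      refine intervalIntegrable_of_bounded (M := K)
        ((hk.comp (by fun_prop)).mul (by fun_prop)) (fun x => ?_) _ _
      refine (abs_mul _ _).trans_le ?_
      exact (mul_le_of_le_one_right (abs_nonneg _) (Real.abs_sin_le_one _)).trans (hK _)
    have h3 := (h1 n).symm.trans (h2 n)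
    have h4 := mul_left_cancel₀ Real.pi_ne_zero h3
    rw [sineMoment]
    simp_rw [sub_mul]
    rw [intervalIntegral.integral_sub (hi hf hM) (hi hg hN)]
    exact sub_eq_zero.2 h4

theorem strictMonoOn_logRatio {L : ℝ} :
    StrictMonoOn (fun z => Real.log ((z - L) / (1 - z))) (Set.Ioo L 1) := by
  intro x hx y hy hxy
  have h1 : 0 < x - L := sub_pos.2 hx.1
  have h2 : 0 < 1 - x := sub_pos.2 hx.2
  have h3 : 0 < 1 - y := sub_pos.2 hy.2
  refine Real.log_lt_log (by positivity) ?_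
  rw [div_lt_div_iff₀ h2 h3]
  nlinarith

theorem logRatio_reflect (L z : ℝ) :
    Real.log ((1 + L - z - L) / (1 - (1 + L - z))) = -Real.log ((z - L) / (1 - z)) := by
  rw [← Real.log_inv, inv_div]
  congr 2 <;> ring

/-- The solvability condition forces the support to be symmetric. -/
theorem two_mul_center_eq_of_integral_eq_zero {L c r : ℝ} (hr : 0 < r) (ha : L ≤ c - r) (hb : c + r ≤ 1)
    (hi : IntervalIntegrable (fun θ => Real.log ((c + r * Real.cos θ - L)
      / (1 - (c + r * Real.cos θ)))) volume 0 Real.pi)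
    (h0 : ∫ θ in (0 : ℝ)..Real.pi, Real.log ((c + r * Real.cos θ - L)
      / (1 - (c + r * Real.cos θ))) = 0) : 2 * c = 1 + L := by
  set h : ℝ → ℝ := fun z => Real.log ((z - L) / (1 - z)) with hh
  set g : ℝ → ℝ := fun θ => h (c + r * Real.cos θ) with hg
  have hi' : IntervalIntegrable (fun θ => g (Real.pi - θ)) volume 0 Real.pi := by
    have := (hi.comp_sub_left Real.pi).symm
    simpa using this
  have hr0 : ∫ θ in (0 : ℝ)..Real.pi, g (Real.pi - θ) = 0 := by
    rw [intervalIntegral.integral_comp_sub_left g]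
    simpa using h0
  have hsum : ∫ θ in (0 : ℝ)..Real.pi, (g θ + g (Real.pi - θ)) = 0 := by
    rw [intervalIntegral.integral_add hi hi', hr0]
    simpa using h0
  have hmem : ∀ θ ∈ Set.Ioo 0 Real.pi, c + r * Real.cos θ ∈ Set.Ioo L 1 ∧
      c - r * Real.cos θ ∈ Set.Ioo L 1 := by
    intro θ hθ
    have h1 : Real.cos θ < 1 := by
      rw [← Real.cos_zero]
      exact Real.cos_lt_cos_of_nonneg_of_le_pi le_rfl hθ.2.le hθ.1
    have h2 : -1 < Real.cos θ := by
      rw [← Real.cos_pi]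
      exact Real.cos_lt_cos_of_nonneg_of_le_pi hθ.1.le le_rfl hθ.2
    refine ⟨⟨?_, ?_⟩, ⟨?_, ?_⟩⟩ <;> nlinarith
  have hgπ : ∀ θ, g (Real.pi - θ) = h (c - r * Real.cos θ) := by
    intro θ
    simp only [hg, Real.cos_pi_sub]
    congr 1
    ring
  -- By this oddness $g(\theta)+g(\pi-\theta)$ is a difference of two values of the increasing
  -- function `h`, at arguments that differ by $2c-(1+L)$. Its sign is therefore constant in
  -- $\theta$ unless $2c=1+L$.
  have hgr : ∀ θ, g θ = -h (1 + L - (c + r * Real.cos θ)) := by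
    intro θ
    simp only [hg, hh]
    rw [logRatio_reflect, neg_neg]
  have hrefl : ∀ {z}, z ∈ Set.Ioo L 1 → 1 + L - z ∈ Set.Ioo L 1 := fun hz =>
    ⟨by linarith [hz.2], by linarith [hz.1]⟩
  rcases lt_trichotomy (2 * c) (1 + L) with hc | hc | hc
  · have hpos : 0 < ∫ θ in (0 : ℝ)..Real.pi, -(g θ + g (Real.pi - θ)) := by
      refine intervalIntegral.intervalIntegral_pos_of_pos_on (hi.add hi').neg (fun θ hθ => ?_)
        Real.pi_pos
      have hm := hmem θ hθ
      have := strictMonoOn_logRatio hm.2 (hrefl hm.1) (by linarith)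
      rw [hgπ, hgr]
      simp only [hh] at this ⊢
      linarith
    rw [intervalIntegral.integral_neg, hsum] at hpos
    simp at hpos
  · exact hc
  · have hpos : 0 < ∫ θ in (0 : ℝ)..Real.pi, (g θ + g (Real.pi - θ)) := by
      refine intervalIntegral.intervalIntegral_pos_of_pos_on (hi.add hi') (fun θ hθ => ?_)
        Real.pi_pos
      have hm := hmem θ hθ
      have := strictMonoOn_logRatio (hrefl hm.1) hm.2 (by linarith)
      rw [hgπ, hgr]
      simp only [hh] at this ⊢
      linarith
    rw [hsum] at hpos
    exact absurd hpos (lt_irrefl _)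

/-! ### The support has no gaps -/

/-- Across a gap of the support the principal value does not increase. -/
theorem hasPV_le_of_gap {f : ℝ → ℝ} (hf : Measurable f) (hfi : Integrable f) {C : ℝ}
    (h0 : ∀ u, 0 ≤ f u) (hC : ∀ u, f u ≤ C) {a b va vb : ℝ} (hab : a < b)
    (hgap : ∀ᵐ u, u ∈ Set.Ioo a b → f u = 0) (ha : HasPV f a va) (hb : HasPV f b vb) :
    vb ≤ va := by
  have hC0 : 0 ≤ C := (h0 0).trans (hC 0)
  have hd : 0 < b - a := sub_pos.2 hab
  -- Outside the gap $f(u)/(b-u)\le f(u)/(a-u)$ wherever both truncations are active. On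
  -- $[a-\varepsilon,a]$ and $[b,b+\varepsilon]$ only one of them is, and the surviving kernel costs
  -- at most $C/(b-a)$; this is the error term.
  have key : ∀ ε ∈ Set.Ioo 0 (b - a), ∫ u in {u : ℝ | ε < |u - b|}, f u / (b - u)
      ≤ (∫ u in {u : ℝ | ε < |u - a|}, f u / (a - u)) + 2 * ε * (C / (b - a)) := by
    intro ε hε
    have hε0 := hε.1
    have hεd := hε.2
    set k : ℝ → ℝ := (Set.Icc (a - ε) a ∪ Set.Icc b (b + ε)).indicator fun _ => C / (b - a) with hk
    have hkI : Integrable k := by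
      refine (integrable_indicator_iff (measurableSet_Icc.union measurableSet_Icc)).2
        (integrableOn_const (measure_union_lt_top (by simp) (by simp)).ne)
    have hkv : ∫ u, k u ≤ 2 * ε * (C / (b - a)) := by
      rw [hk, integral_indicator (measurableSet_Icc.union measurableSet_Icc), setIntegral_const,
        smul_eq_mul]
      refine mul_le_mul_of_nonneg_right ?_ (by positivity)
      refine (measureReal_union_le _ _).trans (le_of_eq ?_)
      rw [Real.volume_real_Icc_of_le (by linarith), Real.volume_real_Icc_of_le (by linarith)]
      ring
    have iA := (integrable_indicator_iff (measurableSet_truncation ε a)).2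
      (integrableOn_truncation_div hf hfi a hε0)
    have iB := (integrable_indicator_iff (measurableSet_truncation ε b)).2
      (integrableOn_truncation_div hf hfi b hε0)
    rw [← integral_indicator (measurableSet_truncation ε a),
      ← integral_indicator (measurableSet_truncation ε b)]
    refine le_trans ?_ (add_le_add le_rfl hkv)
    rw [← integral_add iA hkI]
    refine integral_mono_ae iB (iA.add hkI) ?_
    filter_upwards [hgap] with u hu
    have hfu := h0 u
    have hk0 : 0 ≤ k u := Set.indicator_nonneg (fun _ _ => by positivity) u
    rcases lt_or_ge a u with h1 | h1
    · rcases lt_or_ge u b with h2 | h2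
      · simp only [Set.indicator, hu ⟨h1, h2⟩, zero_div, ite_self, zero_add]
        exact hk0
      · have mA : u ∈ {u : ℝ | ε < |u - a|} := by
          simp only [Set.mem_ofPred_eq]
          rw [abs_of_pos (by linarith)]
          linarith
        rw [Set.indicator_of_mem mA]
        have e1 : f u / (a - u) = -(f u / (u - a)) := by rw [← neg_sub u a, div_neg]
        by_cases hB : ε < |u - b|
        · rw [Set.indicator_of_mem (show u ∈ {u : ℝ | ε < |u - b|} from hB)]
          rw [abs_of_nonneg (by linarith)] at hB
          have hub : 0 < u - b := by linarith
          have e2 : f u / (b - u) = -(f u / (u - b)) := by rw [← neg_sub u b, div_neg]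
          have : f u / (u - a) ≤ f u / (u - b) :=
            div_le_div_of_nonneg_left hfu hub (by linarith)
          rw [e1, e2]
          linarith
        · rw [Set.indicator_of_notMem (show u ∉ {u : ℝ | ε < |u - b|} from hB)]
          rw [abs_of_nonneg (by linarith), not_lt] at hB
          have mk : u ∈ Set.Icc (a - ε) a ∪ Set.Icc b (b + ε) := Or.inr ⟨h2, by linarith⟩
          rw [hk, Set.indicator_of_mem mk, e1]
          have : f u / (u - a) ≤ C / (b - a) := by
            have := hC u
            have : b - a ≤ u - a := by linarith
            gcongr
          linarith
    · have mB : u ∈ {u : ℝ | ε < |u - b|} := by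
        simp only [Set.mem_ofPred_eq]
        rw [abs_of_neg (by linarith)]
        linarith
      rw [Set.indicator_of_mem mB]
      by_cases hA : ε < |u - a|
      · rw [Set.indicator_of_mem (show u ∈ {u : ℝ | ε < |u - a|} from hA)]
        rw [abs_of_nonpos (by linarith)] at hA
        have : f u / (b - u) ≤ f u / (a - u) :=
          div_le_div_of_nonneg_left hfu (by linarith) (by linarith)
        linarith
      · rw [Set.indicator_of_notMem (show u ∉ {u : ℝ | ε < |u - a|} from hA)]
        rw [abs_of_nonpos (by linarith), not_lt] at hA
        have mk : u ∈ Set.Icc (a - ε) a ∪ Set.Icc b (b + ε) := Or.inl ⟨by linarith, h1⟩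
        rw [hk, Set.indicator_of_mem mk, zero_add]
        have := hC u
        have : b - a ≤ b - u := by linarith
        gcongr
  have hlim : Tendsto (fun ε : ℝ => (∫ u in {u : ℝ | ε < |u - a|}, f u / (a - u))
      + 2 * ε * (C / (b - a))) (𝓝[>] 0) (𝓝 va) := by
    have h1 : Tendsto (fun ε : ℝ => 2 * ε * (C / (b - a))) (𝓝[>] 0) (𝓝 0) := by
      have : Tendsto (fun ε : ℝ => 2 * ε * (C / (b - a))) (𝓝 0) (𝓝 (2 * 0 * (C / (b - a)))) :=
        Continuous.tendsto (by fun_prop) 0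
      rw [mul_zero, zero_mul] at this
      exact this.mono_left nhdsWithin_le_nhds
    simpa using Tendsto.add ha h1
  refine le_of_tendsto_of_tendsto hb hlim ?_
  filter_upwards [Ioo_mem_nhdsGT hd] with ε hε using key ε hε

/-- The support of a density that satisfies the equilibrium equation is an interval. -/
theorem eq_Icc_of_hasPV {f : ℝ → ℝ} (hf : Measurable f) (hfi : Integrable f) {C L : ℝ}
    (h0 : ∀ u, 0 ≤ f u) (hC : ∀ u, f u ≤ C) (hs : ∀ u, u ∉ Set.Icc L 1 → f u = 0)
    {S : Set ℝ} (hSc : IsClosed S) (hSL : S ⊆ Set.Icc L 1) (hSn : S.Nonempty)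
    (hSae : ∀ᵐ u, u ∉ S → f u = 0)
    (hSp : ∀ z ∈ S, ∀ U ∈ 𝓝 z, ¬ ∀ᵐ u, u ∈ U → f u = 0)
    (hpv : ∀ z ∈ S, z ∈ Set.Ioo L 1 → HasPV f z (Real.log ((z - L) / (1 - z)))) :
    ∃ a b, a < b ∧ S = Set.Icc a b := by
  have hcomp : IsCompact S := isCompact_Icc.of_isClosed_subset hSc hSL
  have hne : ∀ z : ℝ, ∀ᵐ u : ℝ, u ≠ z := fun z => by
    filter_upwards [(measure_eq_zero_iff_ae_notMem).1 (measure_singleton (μ := volume) z)]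
      with u hu using hu
  obtain ⟨a, haS, hamin⟩ := hcomp.exists_isLeast hSn
  obtain ⟨b, hbS, hbmax⟩ := hcomp.exists_isGreatest hSn
  refine ⟨a, b, lt_of_le_of_ne (hamin hbS) fun hab => ?_, Set.Subset.antisymm
    (fun u hu => ⟨hamin hu, hbmax hu⟩) fun z hz => ?_⟩
  -- A one-point support would carry no mass.
  · refine hSp a haS Set.univ univ_mem ?_
    filter_upwards [hSae, hne a] with u hu hua _
    refine hu fun huS => hua (le_antisymm ?_ (hamin huS))
    rw [hab]
    exact hbmax huS
  · by_contra hzS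
    -- The gap around `z` is bounded by the nearest points of the support on either side.
    obtain ⟨a', ha', ha'max⟩ := (hcomp.inter_right (isClosed_Iic (a := z))).exists_isGreatest
      ⟨a, haS, hz.1⟩
    obtain ⟨b', hb', hb'min⟩ := (hcomp.inter_right (isClosed_Ici (a := z))).exists_isLeast
      ⟨b, hbS, hz.2⟩
    have ha'z : a' < z := lt_of_le_of_ne ha'.2 fun h => hzS (h ▸ ha'.1)
    have hzb' : z < b' := lt_of_le_of_ne hb'.2 fun h => hzS (h ▸ hb'.1)
    have hdisj : ∀ u ∈ Set.Ioo a' b', u ∉ S := by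
      intro u hu huS
      rcases le_total u z with h | h
      · exact absurd (ha'max ⟨huS, h⟩) (not_le.2 hu.1)
      · exact absurd (hb'min ⟨huS, h⟩) (not_le.2 hu.2)
    have hgap : ∀ᵐ u, u ∈ Set.Ioo a' b' → f u = 0 := by
      filter_upwards [hSae] with u hu hmem using hu (hdisj u hmem)
    -- The equation is available only in the open interval $(L,1)$. If a side of the gap were an end
    -- point of $[L,1]$, the density would vanish a.e. near that point of the support.
    have hLa : L < a' := by
      refine lt_of_le_of_ne (hSL ha'.1).1 fun h => ?_
      refine hSp a' ha'.1 (Set.Iio b') (Iio_mem_nhds (ha'z.trans hzb')) ?_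
      filter_upwards [hgap, hne a'] with u hu hua hub
      rcases lt_or_gt_of_ne hua with h1 | h1
      · exact hs u fun hm => absurd hm.1 (by linarith)
      · exact hu ⟨h1, hub⟩
    have hb1 : b' < 1 := by
      refine lt_of_le_of_ne (hSL hb'.1).2 fun h => ?_
      refine hSp b' hb'.1 (Set.Ioi a') (Ioi_mem_nhds (ha'z.trans hzb')) ?_
      filter_upwards [hgap, hne b'] with u hu hua hub
      rcases lt_or_gt_of_ne hua with h1 | h1
      · exact hu ⟨hub, h1⟩
      · exact hs u fun hm => absurd hm.2 (by linarith)
    have hab' : a' < b' := ha'z.trans hzb'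
    have ma : a' ∈ Set.Ioo L 1 := ⟨hLa, hab'.trans hb1⟩
    have mb : b' ∈ Set.Ioo L 1 := ⟨hLa.trans hab', hb1⟩
    have h1 := hasPV_le_of_gap hf hfi h0 hC hab' hgap (hpv a' ha'.1 ma) (hpv b' hb'.1 mb)
    exact absurd (strictMonoOn_logRatio ma mb hab') (not_lt.2 h1)

/-! ### Classification of solutions -/

theorem leftEnd_pos (α β : ℝ) : 0 < leftEnd α β := Real.exp_pos _

theorem leftEnd_lt_one {α β : ℝ} (hα : 0 < α) (hβ : 0 < β) : leftEnd α β < 1 :=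
  Real.exp_lt_one_iff.2 (by linarith)

theorem hasPrincipalValue_iff {L : ℝ} {σ f : ℝ → ℝ} (h : ∀ᵐ u, u ∈ Set.Icc L 1 → σ u = f u)
    (hs : ∀ u, u ∉ Set.Icc L 1 → f u = 0) (z v : ℝ) :
    HasPrincipalValue L σ z v ↔ HasPV f z v := by
  have e : ∀ ε : ℝ, ∫ u in {u : ℝ | u ∈ Set.Icc L 1 ∧ ε < |u - z|}, σ u / (z - u)
      = ∫ u in {u : ℝ | ε < |u - z|}, f u / (z - u) := by
    intro ε
    have hm : MeasurableSet {u : ℝ | u ∈ Set.Icc L 1 ∧ ε < |u - z|} :=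
      measurableSet_Icc.inter (measurableSet_truncation ε z)
    rw [← integral_indicator hm, ← integral_indicator (measurableSet_truncation ε z)]
    refine integral_congr_ae ?_
    filter_upwards [h] with u hu
    by_cases hmem : u ∈ Set.Icc L 1
    · by_cases hε : ε < |u - z|
      · rw [Set.indicator_of_mem (show u ∈ {u : ℝ | u ∈ Set.Icc L 1 ∧ ε < |u - z|} from ⟨hmem, hε⟩),
          Set.indicator_of_mem (show u ∈ {u : ℝ | ε < |u - z|} from hε), hu hmem]
      · rw [Set.indicator_of_notMem
            (show u ∉ {u : ℝ | u ∈ Set.Icc L 1 ∧ ε < |u - z|} from fun h => hε h.2),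
          Set.indicator_of_notMem (show u ∉ {u : ℝ | ε < |u - z|} from hε)]
    · rw [Set.indicator_of_notMem
        (show u ∉ {u : ℝ | u ∈ Set.Icc L 1 ∧ ε < |u - z|} from fun h => hmem h.1)]
      simp [Set.indicator, hs u hmem]
  simp only [HasPrincipalValue, HasPV, e]

theorem densityMeasure_eq_zero_iff {L : ℝ} {σ f : ℝ → ℝ} (hf : Measurable f) (h0 : ∀ u, 0 ≤ f u)
    (h : ∀ᵐ u, u ∈ Set.Icc L 1 → σ u = f u) (hs : ∀ u, u ∉ Set.Icc L 1 → f u = 0)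
    {U : Set ℝ} (hU : MeasurableSet U) :
    densityMeasure L σ U = 0 ↔ ∀ᵐ u, u ∈ U → f u = 0 := by
  have e : densityMeasure L σ = densityMeasure L f := by
    refine withDensity_congr_ae ?_
    filter_upwards [(ae_restrict_iff' measurableSet_Icc).2 h] with u hu
    rw [hu]
  have hm : Measurable fun u => ENNReal.ofReal (f u) := ENNReal.measurable_ofReal.comp hf
  have hset : MeasurableSet ({u | ENNReal.ofReal (f u) ≠ 0} ∩ U) :=
    (hm (measurableSet_singleton 0).compl).inter hU
  rw [e, densityMeasure, withDensity_apply_eq_zero hm, Measure.restrict_apply hset,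
    measure_eq_zero_iff_ae_notMem]
  refine eventually_congr (Eventually.of_forall fun u => ?_)
  simp only [Set.mem_inter_iff, Set.mem_ofPred_eq, ne_eq, ENNReal.ofReal_eq_zero, not_le]
  constructor
  · intro hn hu
    by_contra hne
    refine hn ⟨⟨lt_of_le_of_ne (h0 u) (Ne.symm hne), hu⟩, ?_⟩
    by_contra hmem
    exact hne (hs u hmem)
  · rintro himp ⟨⟨hpos, hu⟩, -⟩
    exact hpos.ne' (himp hu)

/-- A measurable representative is clamped to the known bounds and cut off outside $[L,1]$, so that
the bounds hold everywhere on the line. -/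
theorem IsSolution.exists_measurable_version {α β : ℝ} {σ : ℝ → ℝ} (hσ : IsSolution α β σ) :
    ∃ (f : ℝ → ℝ) (C : ℝ), Measurable f ∧ (∀ u, 0 ≤ f u) ∧ (∀ u, f u ≤ C) ∧
      (∀ u, u ∉ Set.Icc (leftEnd α β) 1 → f u = 0) ∧
      ∀ᵐ u, u ∈ Set.Icc (leftEnd α β) 1 → σ u = f u := by
  obtain ⟨C, hC⟩ := hσ.bounded
  refine ⟨(Set.Icc (leftEnd α β) 1).indicator
    fun u => max 0 (min (hσ.aemeasurable.mk σ u) (max C 0)), max C 0, ?_, ?_, ?_, ?_, ?_⟩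
  · exact (measurable_const.max (hσ.aemeasurable.measurable_mk.min measurable_const)).indicator
      measurableSet_Icc
  · exact fun u => Set.indicator_nonneg (fun _ _ => le_max_left _ _) u
  · intro u
    refine Set.indicator_apply_le' (fun _ => ?_) (fun _ => le_max_right _ _)
    exact max_le (le_max_right _ _) (min_le_right _ _)
  · exact fun u hu => Set.indicator_of_notMem hu _
  · filter_upwards [(ae_restrict_iff' measurableSet_Icc).1 hσ.aemeasurable.ae_eq_mk] with u hu hmem
    rw [Set.indicator_of_mem hmem, ← hu hmem,
      min_eq_left ((hC u hmem).trans (le_max_left _ _)), max_eq_right (hσ.nonneg u hmem)]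

theorem setIntegral_div_eq {L : ℝ} {σ f : ℝ → ℝ} (h : ∀ᵐ u, u ∈ Set.Icc L 1 → σ u = f u)
    (hs : ∀ u, u ∉ Set.Icc L 1 → f u = 0) :
    ∫ u in Set.Icc L 1, σ u / u = ∫ u, f u / u := by
  rw [← setIntegral_eq_integral_of_forall_compl_eq_zero (s := Set.Icc L 1)
    (f := fun u => f u / u) (fun u hu => by simp [hs u hu])]
  refine setIntegral_congr_ae measurableSet_Icc ?_
  filter_upwards [h] with u hu hmem
  rw [hu hmem]

theorem setIntegral_inv_sub {a b z : ℝ} (hab : a ≤ b) (hz : z ∉ Set.Icc a b) :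
    ∫ u in Set.Icc a b, (z - u)⁻¹ = Real.log ((z - a) / (z - b)) := by
  rw [integral_Icc_eq_integral_Ioc, ← intervalIntegral.integral_of_le hab,
    intervalIntegral.integral_comp_sub_left (fun x => x⁻¹), integral_inv]
  rw [Set.uIcc_of_le (by linarith)]
  exact fun h => hz ⟨by linarith [h.2], by linarith [h.1]⟩

/-- The principal value of the constant density one. -/
theorem hasPV_indicator_one {L z : ℝ} (hz : z ∈ Set.Ioo L 1) :
    HasPV ((Set.Icc L 1).indicator fun _ => 1) z (Real.log ((z - L) / (1 - z))) := by
  have h1 : 0 < z - L := sub_pos.2 hz.1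
  have h2 : 0 < 1 - z := sub_pos.2 hz.2
  refine tendsto_const_nhds.congr' ?_
  -- Once both pieces are nonempty the truncated integral is
  -- $\ln\frac{z-L}{\varepsilon}+\ln\frac{\varepsilon}{1-z}$, which does not depend on
  -- $\varepsilon$.
  filter_upwards [Ioo_mem_nhdsGT (lt_min h1 h2)] with ε hε
  have hε0 := hε.1
  have hε1 := (lt_min_iff.1 hε.2).1
  have hε2 := (lt_min_iff.1 hε.2).2
  have e : ∫ u in {u : ℝ | ε < |u - z|}, (Set.Icc L 1).indicator (fun _ => (1 : ℝ)) u / (z - u)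
      = ∫ u in Set.Icc L (z - ε) ∪ Set.Icc (z + ε) 1, (z - u)⁻¹ := by
    rw [← integral_indicator (measurableSet_truncation ε z),
      ← integral_indicator (measurableSet_Icc.union measurableSet_Icc)]
    refine integral_congr_ae ?_
    filter_upwards [(measure_eq_zero_iff_ae_notMem).1 (measure_singleton (μ := volume) (z - ε)),
      (measure_eq_zero_iff_ae_notMem).1 (measure_singleton (μ := volume) (z + ε))] with u hu1 hu2
    have hu1 : u ≠ z - ε := hu1
    have hu2 : u ≠ z + ε := hu2
    by_cases hA : ε < |u - z|
    · rw [Set.indicator_of_mem (show u ∈ {u : ℝ | ε < |u - z|} from hA)]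
      by_cases hI : u ∈ Set.Icc L 1
      · have : u ∈ Set.Icc L (z - ε) ∪ Set.Icc (z + ε) 1 := by
          rcases lt_abs.1 hA with h | h
          · exact Or.inr ⟨by linarith, hI.2⟩
          · exact Or.inl ⟨hI.1, by linarith⟩
        rw [Set.indicator_of_mem hI, Set.indicator_of_mem this, one_div]
      · have : u ∉ Set.Icc L (z - ε) ∪ Set.Icc (z + ε) 1 := by
          rintro (h | h)
          · exact hI ⟨h.1, by linarith [h.2]⟩
          · exact hI ⟨by linarith [h.1], h.2⟩
        rw [Set.indicator_of_notMem hI, Set.indicator_of_notMem this, zero_div]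
    · have : u ∉ Set.Icc L (z - ε) ∪ Set.Icc (z + ε) 1 := by
        rintro (h | h)
        · exact hA (lt_abs.2 (Or.inr (by linarith [lt_of_le_of_ne h.2 hu1])))
        · exact hA (lt_abs.2 (Or.inl (by linarith [lt_of_le_of_ne h.1 hu2.symm])))
      rw [Set.indicator_of_notMem (show u ∉ {u : ℝ | ε < |u - z|} from hA),
        Set.indicator_of_notMem this]
  have hint : ∀ {a b : ℝ}, z ∉ Set.Icc a b → IntegrableOn (fun u => (z - u)⁻¹) (Set.Icc a b) := by
    intro a b hzab
    refine ContinuousOn.integrableOn_Icc (ContinuousOn.inv₀ (by fun_prop) fun u hu h => hzab ?_)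
    rwa [sub_eq_zero.1 h]
  have n1 : z ∉ Set.Icc L (z - ε) := fun h => by linarith [h.2]
  have n2 : z ∉ Set.Icc (z + ε) 1 := fun h => by linarith [h.1]
  rw [e, setIntegral_union (Set.disjoint_left.2 fun u h h' => by linarith [h.2, h'.1])
    measurableSet_Icc (hint n1) (hint n2), setIntegral_inv_sub (by linarith) n1,
    setIntegral_inv_sub (by linarith) n2, sub_sub_cancel,
    show (z - (z + ε)) / (z - 1) = ε / (1 - z) by
      rw [show z - (z + ε) = -ε by ring, ← neg_sub 1 z, neg_div_neg_eq],
    ← Real.log_mul (by positivity) (by positivity)]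
  congr 1
  field_simp

theorem integral_indicator_one_div {α β : ℝ} (hα : 0 < α) (hβ : 0 < β) :
    ∫ u, (Set.Icc (leftEnd α β) 1).indicator (fun _ => (1 : ℝ)) u / u = α + β := by
  have e : ∀ u, (Set.Icc (leftEnd α β) 1).indicator (fun _ => (1 : ℝ)) u / u
      = (Set.Icc (leftEnd α β) 1).indicator (fun u => u⁻¹) u := by
    intro u
    by_cases hu : u ∈ Set.Icc (leftEnd α β) 1 <;> simp [hu]
  have hL := leftEnd_pos α β
  have hL1 := leftEnd_lt_one hα hβ
  simp_rw [e]
  rw [integral_indicator measurableSet_Icc, integral_Icc_eq_integral_Ioc,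
    ← intervalIntegral.integral_of_le hL1.le, integral_inv_of_pos hL one_pos, one_div,
    Real.log_inv, leftEnd, Real.log_exp]
  ring

/-- Every solution is an arctangent density. -/
theorem IsSolution.exists_arcDensity {α β : ℝ} (hα : 0 < α) (hβ : 0 < β) {σ : ℝ → ℝ}
    (hσ : IsSolution α β σ) :
    ∃ a b, leftEnd α β < a ∧ a < b ∧ a + b = 1 + leftEnd α β ∧
      a * b = leftEnd α β * (1 + Real.exp (-α)) ^ 2 / (4 * Real.exp (-α)) ∧
      ∀ᵐ u, u ∈ Set.Icc (leftEnd α β) 1 → σ u = arcDensity a b u := by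
  obtain ⟨f, C, hf, h0, hC, hs, hσf⟩ := hσ.exists_measurable_version
  set L := leftEnd α β with hL
  have habs : ∀ u, |f u| ≤ C := fun u => by rw [abs_of_nonneg (h0 u)]; exact hC u
  have hfi : Integrable f := integrable_of_bounded_of_support hf habs hs
  have hfβ : ∫ u, f u / u = β := by rw [← setIntegral_div_eq hσf hs]; exact hσ.constraint
  have hnull := fun {U : Set ℝ} (hU : MeasurableSet U) =>
    densityMeasure_eq_zero_iff hf h0 hσf hs hU
  set S := (densityMeasure L σ).support with hS
  have hSc : IsClosed S := Measure.isClosed_support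
  have hSae : ∀ᵐ u, u ∉ S → f u = 0 :=
    (hnull hSc.measurableSet.compl).1 Measure.measure_compl_support
  have hSp : ∀ z ∈ S, ∀ U ∈ 𝓝 z, ¬ ∀ᵐ u, u ∈ U → f u = 0 := by
    intro z hz U hU hae
    obtain ⟨V, hVU, hVo, hzV⟩ := mem_nhds_iff.1 hU
    have hV : densityMeasure L σ V = 0 := (hnull hVo.measurableSet).2 (by
      filter_upwards [hae] with u hu huV using hu (hVU huV))
    exact ((Measure.mem_support_iff_forall z).1 hz V (hVo.mem_nhds hzV)).ne' hV
  have hSL : S ⊆ Set.Icc L 1 := by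
    refine Measure.support_subset_of_isClosed isClosed_Icc ?_
    rw [mem_ae_iff, hnull measurableSet_Icc.compl]
    exact ae_of_all _ fun u hu => hs u hu
  have hSn : S.Nonempty := by
    by_contra hne
    rw [Set.not_nonempty_iff_eq_empty] at hne
    have : ∫ u, f u / u = 0 := by
      refine integral_eq_zero_of_ae ?_
      filter_upwards [hSae] with u hu
      simp [hu (by simp [hne])]
    linarith
  have hpv : ∀ z ∈ S, z ∈ Set.Ioo L 1 → HasPV f z (Real.log ((z - L) / (1 - z))) :=
    fun z hz hz' => (hasPrincipalValue_iff hσf hs z _).1 (hσ.integral_equation z hz' hz)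
  obtain ⟨a, b, hab, hSab⟩ := eq_Icc_of_hasPV hf hfi h0 hC hs hSc hSL hSn hSae hSp hpv
  have haL : L ≤ a := (hSL (hSab ▸ Set.left_mem_Icc.2 hab.le)).1
  have hb1 : b ≤ 1 := (hSL (hSab ▸ Set.right_mem_Icc.2 hab.le)).2
  obtain ⟨c, r, rfl, rfl⟩ : ∃ c r, a = c - r ∧ b = c + r :=
    ⟨(a + b) / 2, (b - a) / 2, by ring, by ring⟩
  have hr : 0 < r := by linarith
  set g := (Set.Icc (c - r) (c + r)).indicator f with hg
  have hgm : Measurable g := hf.indicator measurableSet_Icc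
  have hgC : ∀ u, |g u| ≤ C := fun u => by
    rw [← Real.norm_eq_abs]
    exact (norm_indicator_le_norm_self _ _).trans (habs u)
  have hgs : ∀ u, u ∉ Set.Icc (c - r) (c + r) → g u = 0 := fun u hu =>
    Set.indicator_of_notMem hu _
  have hfg : ∀ᵐ u, f u = g u := by
    filter_upwards [hSae] with u hu
    by_cases hm : u ∈ Set.Icc (c - r) (c + r)
    · rw [hg, Set.indicator_of_mem hm]
    · rw [hgs u hm, hu (by rwa [hSab])]
  have hgpv : ∀ z ∈ Set.Ioo (c - r) (c + r), HasPV g z (Real.log ((z - L) / (1 - z))) :=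
    fun z hz => (hpv z (hSab ▸ Set.Ioo_subset_Icc_self hz)
      ⟨haL.trans_lt hz.1, hz.2.trans_le hb1⟩).congr_ae hfg
  have hcoef := integral_pv_mul_cos hgm hgC hr hgs (h := fun z => Real.log ((z - L) / (1 - z))) hgpv
  -- The zeroth sine moment vanishes identically; this is the solvability condition.
  have hcen : 2 * c = 1 + L := by
    refine two_mul_center_eq_of_integral_eq_zero hr haL hb1 hcoef.1 ?_
    simpa [sineMoment] using hcoef.2 0
  have hgβ : ∫ u, g u / u = β := by
    rw [← hfβ]
    refine integral_congr_ae ?_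
    filter_upwards [hfg] with u hu
    rw [hu]
  rcases haL.eq_or_lt with haL' | haL'
  -- With support $[L,1]$ the density is $1$ by uniqueness, and its weighted mass $\alpha+\beta$
  -- contradicts the constraint.
  · exfalso
    have hb' : c + r = 1 := by linarith
    have heq := ae_eq_of_hasPV (h := fun z => Real.log ((z - L) / (1 - z))) (N := 1) hgm
      (measurable_const.indicator (measurableSet_Icc (a := L) (b := 1)) :
        Measurable ((Set.Icc L 1).indicator fun _ => (1 : ℝ))) hgC
      (fun u => (norm_indicator_le_norm_self (fun _ => (1 : ℝ)) u).trans (by simp)) hr hgs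
      (fun u hu => Set.indicator_of_notMem (by rwa [haL', ← hb']) _) hgpv
      (fun z hz => hasPV_indicator_one (by rwa [haL', ← hb']))
    have hI := integral_indicator_one_div hα hβ
    have : ∫ u, g u / u = α + β := by
      rw [← hI]
      refine integral_congr_ae ?_
      filter_upwards [heq] with u hu
      rw [hu]
    linarith
  · obtain ⟨q, hq0, hq1, hq⟩ := exists_joukowski_param (s := 1 - c) hr (by linarith)
    have hLc : L = 2 * c - 1 := by linarith
    have heq := ae_eq_of_hasPV (h := fun z => Real.log ((z - L) / (1 - z))) hgm
      (measurable_arcDensity (c - r) (c + r)) hgC (abs_arcDensity_le _ _) hr hgs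
      (arcDensity_eq_zero_of_notMem hr hq0 hq1 hq) hgpv
      (fun z hz => by rw [hLc]; exact hasPV_arcDensity hr hq0 hq1 hq (Set.Ioo_subset_Icc_self hz))
    have hsum : c - r + (c + r) = 1 + L := by linarith
    refine ⟨c - r, c + r, haL', hab, hsum,
      (integral_arcDensity_div_eq_iff hα haL' hab hsum).1 ?_, ?_⟩
    · rw [← hgβ]
      refine integral_congr_ae ?_
      filter_upwards [heq] with u hu
      rw [hu]
    · filter_upwards [hσf, hfg, heq] with u h1 h2 h3 hu
      rw [h1 hu, h2, h3]

/-! ### Return to the variable `μ` and the explicit end points -/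

/-- With $e^{-\mu/2}$ moved under the root, both radicands are the same rational function of
$e^{-A/2}$, $e^{-B/2}$ and $e^{-\mu/2}$. -/
theorem limitDensity_eq_arcDensity {A B : ℝ} (hB : 0 < B) (hBA : B < A) (μ : ℝ) :
    limitDensity A B μ = arcDensity (Real.exp (-A)) (Real.exp (-B)) (Real.exp (-μ)) := by
  by_cases hμ : μ ∈ Set.Icc B A
  · rw [limitDensity, if_pos hμ, arcDensity]
    congr 2
    have hx0 := Real.exp_pos (-μ / 2)
    nth_rw 1 [← Real.sqrt_sq hx0.le]
    rw [← Real.sqrt_mul (sq_nonneg _)]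
    congr 1
    have hexp : ∀ t : ℝ, Real.exp (-t) = Real.exp (-t / 2) ^ 2 := fun t => by
      rw [← Real.exp_nat_mul]
      congr 1
      push_cast
      ring
    have hsinh : ∀ t : ℝ, Real.sinh (t / 2) = ((Real.exp (-t / 2))⁻¹ - Real.exp (-t / 2)) / 2 :=
      fun t => by
        rw [Real.sinh_eq, ← Real.exp_neg]
        congr 3 <;> ring
    have hsub : ∀ s t : ℝ, Real.exp (-(s - t) / 2) = Real.exp (-s / 2) / Real.exp (-t / 2) :=
      fun s t => by
        rw [← Real.exp_sub]
        congr 1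
        ring
    have hA1 : Real.exp (-A / 2) < 1 := Real.exp_lt_one_iff.2 (by linarith)
    have hB1 : Real.exp (-B / 2) < 1 := Real.exp_lt_one_iff.2 (by linarith)
    rw [hexp A, hexp B, hexp μ, hsinh, hsinh, hsinh, hsinh, hsub, hsub]
    have hs0 := Real.exp_pos (-A / 2)
    have ht0 := Real.exp_pos (-B / 2)
    generalize Real.exp (-A / 2) = s at *
    generalize Real.exp (-B / 2) = t at *
    generalize Real.exp (-μ / 2) = x at *
    have h1 : 1 - s ^ 2 ≠ 0 := by nlinarith
    have h2 : 1 - t ^ 2 ≠ 0 := by nlinarith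
    field_simp
    ring
  · rw [limitDensity, if_neg hμ, arcDensity_eq_zero (Real.exp_lt_exp.2 (by linarith))
      (Real.exp_lt_one_iff.2 (by linarith))]
    exact fun h => hμ ⟨by linarith [Real.exp_lt_exp.1 h.2], by linarith [Real.exp_lt_exp.1 h.1]⟩

theorem tsupport_limitDensity {A B : ℝ} (hB : 0 < B) (hBA : B < A) :
    tsupport (limitDensity A B) = Set.Icc B A := by
  have hb1 : Real.exp (-B) < 1 := Real.exp_lt_one_iff.2 (by linarith)
  have hab : Real.exp (-A) < Real.exp (-B) := Real.exp_lt_exp.2 (by linarith)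
  have hiff : ∀ μ, Real.exp (-μ) ∈ Set.Ioo (Real.exp (-A)) (Real.exp (-B)) ↔ μ ∈ Set.Ioo B A := by
    intro μ
    rw [Set.mem_Ioo, Set.mem_Ioo, Real.exp_lt_exp, Real.exp_lt_exp, neg_lt_neg_iff, neg_lt_neg_iff,
      and_comm]
  have : Function.support (limitDensity A B) = Set.Ioo B A := by
    ext μ
    rw [Function.mem_support, limitDensity_eq_arcDensity hB hBA]
    constructor
    · intro h
      by_contra hn
      exact h (arcDensity_eq_zero hab hb1 fun h' => hn ((hiff μ).1 h'))
    · intro h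
      exact (arcDensity_pos hb1 ((hiff μ).2 h)).ne'
  rw [tsupport, this, closure_Ioo hBA.ne]

/-- Here $x=e^{-\alpha/2}$, $y=e^{-\beta/2}$, and $xyD$ is half the length of the support. The
inequality keeps both end points inside $(L,1)$ at once, by symmetry; the difference of the squares
is $y^2(1-x^2)^2/4$. -/
theorem endpoints_algebra {x y D : ℝ} (hx0 : 0 < x) (hx1 : x < 1) (hy0 : 0 < y) (hy1 : y < 1)
    (hDsq : D ^ 2 = (y⁻¹ - y) / 2 * (((x ^ 2 * y)⁻¹ - x ^ 2 * y) / 2)) :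
    x * y * D < (1 - (x * y) ^ 2) / 2 ∧
      ((1 + (x * y) ^ 2) / 2 - x * y * D) * ((1 + (x * y) ^ 2) / 2 + x * y * D)
        = (x * y) ^ 2 * (1 + x ^ 2) ^ 2 / (4 * x ^ 2) := by
  have hT : (x * y * D) ^ 2 = (1 - y ^ 2) * (1 - x ^ 4 * y ^ 2) / 4 := by
    rw [mul_pow, hDsq]
    field_simp
    ring
  have hxy : x * y < 1 := mul_lt_one_of_nonneg_of_lt_one_left hx0.le hx1 hy1.le
  constructor
  · have h2 : (x * y) ^ 2 < 1 := pow_lt_one₀ (by positivity) hxy two_ne_zero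
    refine lt_of_pow_lt_pow_left₀ 2 (by linarith) ?_
    rw [hT]
    have h3 : 0 < 1 - x ^ 2 := sub_pos.2 (pow_lt_one₀ hx0.le hx1 two_ne_zero)
    have h4 : ((1 - (x * y) ^ 2) / 2) ^ 2
        = (1 - y ^ 2) * (1 - x ^ 4 * y ^ 2) / 4 + y ^ 2 * (1 - x ^ 2) ^ 2 / 4 := by ring
    rw [h4]
    have : 0 < y ^ 2 * (1 - x ^ 2) ^ 2 / 4 := by positivity
    linarith
  · rw [show ((1 + (x * y) ^ 2) / 2 - x * y * D) * ((1 + (x * y) ^ 2) / 2 + x * y * D)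
      = ((1 + (x * y) ^ 2) / 2) ^ 2 - (x * y * D) ^ 2 by ring, hT]
    field_simp
    ring

/-- The end points of the support, in the variable `u`. -/
theorem endpoints_spec {α β : ℝ} (hα : 0 < α) (hβ : 0 < β) {a b : ℝ}
    (ha : a = Real.exp (-(α + β) / 2) * (Real.cosh ((α + β) / 2)
      - √(Real.sinh (β / 2) * Real.sinh ((2 * α + β) / 2))))
    (hb : b = Real.exp (-(α + β) / 2) * (Real.cosh ((α + β) / 2)
      + √(Real.sinh (β / 2) * Real.sinh ((2 * α + β) / 2)))) :
    leftEnd α β < a ∧ a < b ∧ b < 1 ∧ a + b = 1 + leftEnd α β ∧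
      a * b = leftEnd α β * (1 + Real.exp (-α)) ^ 2 / (4 * Real.exp (-α)) := by
  set D := √(Real.sinh (β / 2) * Real.sinh ((2 * α + β) / 2)) with hD
  have hprod : 0 < Real.sinh (β / 2) * Real.sinh ((2 * α + β) / 2) :=
    mul_pos (Real.sinh_pos_iff.2 (by linarith)) (Real.sinh_pos_iff.2 (by linarith))
  have hDpos : 0 < D := Real.sqrt_pos.2 hprod
  have hDsq : D ^ 2 = Real.sinh (β / 2) * Real.sinh ((2 * α + β) / 2) := Real.sq_sqrt hprod.le
  set x := Real.exp (-α / 2) with hx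
  set y := Real.exp (-β / 2) with hy
  have hx0 : 0 < x := Real.exp_pos _
  have hy0 : 0 < y := Real.exp_pos _
  have hx1 : x < 1 := Real.exp_lt_one_iff.2 (by linarith)
  have hy1 : y < 1 := Real.exp_lt_one_iff.2 (by linarith)
  have eS : Real.exp (-(α + β) / 2) = x * y := by
    rw [hx, hy, ← Real.exp_add]
    congr 1
    ring
  have eα : Real.exp (-α) = x ^ 2 := by
    rw [hx, ← Real.exp_nat_mul]
    congr 1
    push_cast
    ring
  have eL : leftEnd α β = (x * y) ^ 2 := by
    rw [leftEnd, ← eS, ← Real.exp_nat_mul]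
    congr 1
    push_cast
    ring
  have ec : Real.cosh ((α + β) / 2) = ((x * y)⁻¹ + x * y) / 2 := by
    rw [Real.cosh_eq, ← eS, ← Real.exp_neg]
    congr 3 <;> ring
  have es1 : Real.sinh (β / 2) = (y⁻¹ - y) / 2 := by
    rw [Real.sinh_eq, hy, ← Real.exp_neg]
    congr 3 <;> ring
  have es2 : Real.sinh ((2 * α + β) / 2) = ((x ^ 2 * y)⁻¹ - x ^ 2 * y) / 2 := by
    have : x ^ 2 * y = Real.exp (-(2 * α + β) / 2) := by
      rw [← eα, hy, ← Real.exp_add]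
      congr 1
      ring
    rw [Real.sinh_eq, this, ← Real.exp_neg]
    congr 3 <;> ring
  rw [es1, es2] at hDsq
  obtain ⟨hTlt, hTprod⟩ := endpoints_algebra hx0 hx1 hy0 hy1 hDsq
  have hTpos : 0 < x * y * D := by positivity
  have ha' : a = (1 + (x * y) ^ 2) / 2 - x * y * D := by
    rw [ha, eS, ec]
    field_simp
  have hb' : b = (1 + (x * y) ^ 2) / 2 + x * y * D := by
    rw [hb, eS, ec]
    field_simp
  rw [eL, eα, ← hTprod]
  exact ⟨by linarith, by linarith, by linarith, by linarith, by rw [ha', hb']⟩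

/-- The arctangent density solves the equilibrium problem. -/
theorem isSolution_of_eq_arcDensity {α β a b : ℝ} (hα : 0 < α) (hLa : leftEnd α β < a)
    (hab : a < b) (hs : a + b = 1 + leftEnd α β)
    (hp : a * b = leftEnd α β * (1 + Real.exp (-α)) ^ 2 / (4 * Real.exp (-α)))
    {σ : ℝ → ℝ} (hσ : ∀ u ∈ Set.Icc (leftEnd α β) 1, σ u = arcDensity a b u) :
    IsSolution α β σ := by
  have hb1 : b < 1 := by linarith
  have hσae : ∀ᵐ u, u ∈ Set.Icc (leftEnd α β) 1 → σ u = arcDensity a b u := ae_of_all _ hσ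
  have hzero : ∀ u, u ∉ Set.Icc (leftEnd α β) 1 → arcDensity a b u = 0 := fun u hu =>
    arcDensity_eq_zero hab hb1 fun h => hu ⟨by linarith [h.1], by linarith [h.2]⟩
  refine ⟨?_, ?_, ?_, ?_, ?_⟩
  · exact (measurable_arcDensity a b).aemeasurable.congr
      ((ae_restrict_iff' measurableSet_Icc).2 (ae_of_all _ fun u hu => (hσ u hu).symm))
  · intro u hu
    rw [hσ u hu]
    exact arcDensity_nonneg a b u
  · refine ⟨1, fun u hu => ?_⟩
    rw [hσ u hu]
    exact arcDensity_le_one a b u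
  · intro z _ hzS
    have hz : z ∈ Set.Icc a b := by
      refine Measure.support_subset_of_isClosed isClosed_Icc ?_ hzS
      rw [mem_ae_iff, densityMeasure_eq_zero_iff (measurable_arcDensity a b)
        (arcDensity_nonneg a b) hσae hzero measurableSet_Icc.compl]
      exact ae_of_all _ fun u hu => arcDensity_eq_zero hab hb1
        fun h => hu (Set.Ioo_subset_Icc_self h)
    rw [hasPrincipalValue_iff hσae hzero]
    obtain ⟨c, r, rfl, rfl⟩ : ∃ c r, a = c - r ∧ b = c + r :=
      ⟨(a + b) / 2, (b - a) / 2, by ring, by ring⟩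
    have hr : 0 < r := by linarith
    obtain ⟨q, hq0, hq1, hq⟩ := exists_joukowski_param (s := 1 - c) hr (by linarith)
    have hL : leftEnd α β = 2 * c - 1 := by linarith
    rw [hL]
    exact hasPV_arcDensity hr hq0 hq1 hq hz
  · rw [setIntegral_div_eq hσae hzero]
    exact (integral_arcDensity_div_eq_iff hα hLa hab hs).2 hp

/-- The exceptional set in $\mu$ lies in the image of a null set of $[L,1]$ under $-\ln$, which is
differentiable there and so preserves null sets. -/
theorem ae_comp_exp_neg {α β : ℝ} {P : ℝ → Prop}
    (h : ∀ᵐ u, u ∈ Set.Icc (leftEnd α β) 1 → P u) :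
    ∀ᵐ μ ∂(volume.restrict (Set.Icc 0 (α + β))), P (Real.exp (-μ)) := by
  rw [ae_restrict_iff' measurableSet_Icc, ae_iff]
  have hN : volume {u | ¬(u ∈ Set.Icc (leftEnd α β) 1 → P u)} = 0 := ae_iff.1 h
  have hd : DifferentiableOn ℝ (fun u => -Real.log u)
      {u | ¬(u ∈ Set.Icc (leftEnd α β) 1 → P u)} := by
    intro u hu
    have hu : ¬(u ∈ Set.Icc (leftEnd α β) 1 → P u) := hu
    have hmem : u ∈ Set.Icc (leftEnd α β) 1 := by_contra fun hn => hu fun h' => absurd h' hn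
    exact (Real.differentiableAt_log
      ((leftEnd_pos α β).trans_le hmem.1).ne').neg.differentiableWithinAt
  refine measure_mono_null ?_ (addHaar_image_eq_zero_of_differentiableOn_of_addHaar_eq_zero
    volume hd hN)
  intro μ hμ
  have hμ : ¬(μ ∈ Set.Icc 0 (α + β) → P (Real.exp (-μ))) := hμ
  refine ⟨Real.exp (-μ), fun hP => hμ fun hm => hP ⟨?_, ?_⟩, by simp⟩
  · rw [leftEnd, Real.exp_le_exp]
    linarith [hm.2]
  · exact Real.exp_le_one_iff.2 (by linarith [hm.1])

end CutHexagon

end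

theorem mainTheorem1 (α β : ℝ) (hα : 0 < α) (hβ : 0 < β) :
    ∃ A B : ℝ,
      Real.exp (-B) = Real.exp (-(α + β) / 2) * (Real.cosh ((α + β) / 2)
        + Real.sqrt (Real.sinh (β / 2) * Real.sinh ((2 * α + β) / 2))) ∧
      Real.exp (-A) = Real.exp (-(α + β) / 2) * (Real.cosh ((α + β) / 2)
        - Real.sqrt (Real.sinh (β / 2) * Real.sinh ((2 * α + β) / 2))) ∧
      0 < B ∧ B < A ∧ A < α + β ∧
      tsupport (CutHexagon.limitDensity A B) = Set.Icc B A ∧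
      CutHexagon.IsSolution α β (fun u => CutHexagon.limitDensity A B (-Real.log u)) ∧
      ∀ σ : ℝ → ℝ, CutHexagon.IsSolution α β σ →
        ∀ᵐ μ ∂(volume.restrict (Set.Icc 0 (α + β))),
          σ (Real.exp (-μ)) = CutHexagon.limitDensity A B μ := by
  obtain ⟨a, ha⟩ : ∃ a, a = Real.exp (-(α + β) / 2) * (Real.cosh ((α + β) / 2)
    - Real.sqrt (Real.sinh (β / 2) * Real.sinh ((2 * α + β) / 2))) := ⟨_, rfl⟩
  obtain ⟨b, hb⟩ : ∃ b, b = Real.exp (-(α + β) / 2) * (Real.cosh ((α + β) / 2)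
    + Real.sqrt (Real.sinh (β / 2) * Real.sinh ((2 * α + β) / 2))) := ⟨_, rfl⟩
  obtain ⟨hLa, hab, hb1, hs, hp⟩ := CutHexagon.endpoints_spec hα hβ ha hb
  have hL0 := CutHexagon.leftEnd_pos α β
  have ha0 : 0 < a := hL0.trans hLa
  have hb0 : 0 < b := ha0.trans hab
  have eA : Real.exp (-(-Real.log a)) = a := by rw [neg_neg, Real.exp_log ha0]
  have eB : Real.exp (-(-Real.log b)) = b := by rw [neg_neg, Real.exp_log hb0]
  have hB : 0 < -Real.log b := neg_pos.2 (Real.log_neg hb0 hb1)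
  have hBA : -Real.log b < -Real.log a := neg_lt_neg (Real.log_lt_log ha0 hab)
  refine ⟨-Real.log a, -Real.log b, eB.trans hb, eA.trans ha, hB, hBA, ?_,
    CutHexagon.tsupport_limitDensity hB hBA, ?_, fun σ hσ => ?_⟩
  · have := Real.log_lt_log hL0 hLa
    rw [CutHexagon.leftEnd, Real.log_exp] at this
    linarith
  · refine CutHexagon.isSolution_of_eq_arcDensity hα hLa hab hs hp fun u hu => ?_
    rw [CutHexagon.limitDensity_eq_arcDensity hB hBA, eA, eB, neg_neg,
      Real.exp_log (hL0.trans_le hu.1)]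
  · obtain ⟨a', b', hLa', hab', hs', hp', hσ'⟩ := hσ.exists_arcDensity hα hβ
    -- Equal sums and products give $(b'-a')^2=(b-a)^2$, and both differences are positive.
    have hd : (b' - a' - (b - a)) * (b' - a' + (b - a)) = 0 := by
      linear_combination (a' + b' + a + b) * (hs'.trans hs.symm) - 4 * (hp'.trans hp.symm)
    have hd' : b' - a' = b - a := by
      rcases mul_eq_zero.1 hd with h | h <;> linarith
    obtain rfl : a' = a := by linarith
    obtain rfl : b' = b := by linarith
    filter_upwards [CutHexagon.ae_comp_exp_neg hσ'] with μ hμ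
    rw [hμ, CutHexagon.limitDensity_eq_arcDensity hB hBA, eA, eB]
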